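/- Let $n\ge 1$, let $B^n$ be the open unit ball of $\mathbb C^n$ and $S=\partial B^n$ its unit sphere. Let $\sigma$ be the normalized Lebesgue measure on $S$ and $V$ the Lebesgue measure on $\overline{B^n}$. For $x,y\in\overline{B^n}$ put $d(x,y)=|1-x\bar y|$, where $x\bar y=\sum_i x_i\overline{y_i}$, and for $E\subset S$ put $d(z,E)=\inf_{y\in E}d(z,y)$ (with $d(z,\emptyset)=+\infty$). In statements about $\sigma$, $B(x,R)=\{z\in S: d(z,x)<R\}$ and $E_\varepsilon=\{z\in S: d(z,E)<\varepsilon\}$; in statements about $V$, $B(x,R)$ and $E_\varepsilon$ are the corresponding subsets of $\overline{B^n}$. For $x\in E$, $R>0$, $k\ge1$, let $N(x,R,k)$ be the maximal number of points $t_i\in E$ with $d(t_i,x)<kR$ and $d(t_i,t_j)\ge R$ for $i\ne j$. The upper dimension $\Upsilon(E)$ is the infimum of all real $\gamma$ for which there is a $C>0$ with $N(x,R,k)\le Ck^\gamma$ for all $x\in E$ and $0<R\le kR\le 1$. Let $E\subset S$ be a closed set. Then the following statements are equivalent: (a) (Uniform Hole Condition) There is $0<C<1$ such that for all $x\in S$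 and all $0<r\le 2=\operatorname{diam}_d(S)$, $\sup\{d(y,E): y\in B(x,r)\}\ge Cr$. (b) There are $s<n$ and $C>0$ such that for all $x\in S$, $R>0$ and $0<\varepsilon<R$, $\sigma(B(x,R)\cap E_\varepsilon)\le CR^s\varepsilon^{n-s}$ (condition $\Sigma_s$). (c) $\Upsilon(E)<n$. (d) There are $a>0$ and $C>0$ such that for all $x\in S$ and $R>0$, $$\int_{B(x,R)}d(z,E)^{-a}\,d\sigma(z)\le CR^{n-a}.$$ (e) There is $C>0$ such that for all $x\in S$ and $R>0$, $$\int_{B(x,R)}\log\bigl(d(z,E)^{-1}\bigr)\,d\sigma(z)\le\sigma(B(x,R))\log\frac1R+CR^n.$$ (f) There are $0<a<n$ and $C>0$ such that for all $x\in E$ and $R>0$, $$\int_0^R N\Bigl(x,\delta,\frac R\delta\Bigr)\,\delta^{n-a}\,\frac{d\delta}\delta\le CR^{n-a}.$$ (g) There are $s<n$ and $C>0$ such that for all $x\in E$, $R>0$ and $0<\varepsilon<R$, $V(B(x,R)\cap E_\varepsilon)\le CR^s\varepsilon^{n+1-s}$. (h) There is $a_0>1$ such that for every $0\le a<a_0$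 there is $C>0$ such that for all $x\in S$ and $R>0$, $$\int_{B(x,R)}d(z,E)^{-a}\,dV(z)\le CR^{n+1-a}.$$ The integrands in (d), (e) and (h) (for $a>0$) take the value $+\infty$ on $E$. -/

import Mathlib

open MeasureTheory
open scoped ENNReal

namespace NonIso

noncomputable section

/-- `ℂⁿ` with its Hermitian (Euclidean) norm. -/
abbrev Cn (n : ℕ) : Type := EuclideanSpace ℂ (Fin n)

/-- The unit sphere `S = ∂Bⁿ` of `ℂⁿ`. -/
abbrev S (n : ℕ) : Set (Cn n) := Metric.sphere 0 1

/-- The closed unit ball of `ℂⁿ`. -/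
abbrev clB (n : ℕ) : Set (Cn n) := Metric.closedBall 0 1

/-- Normalized Lebesgue (surface) measure `σ` on the sphere, as a measure on `ℂⁿ` carried by `S`. -/
def sigma (n : ℕ) : Measure (Cn n) :=
  ((volume : Measure (Cn n)).toSphere Set.univ)⁻¹ •
    ((volume : Measure (Cn n)).toSphere.map Subtype.val)

/-- Lebesgue measure `V` on the closed unit ball. -/
def V (n : ℕ) : Measure (Cn n) := volume.restrict (clB n)

variable {n : ℕ}

/-- `d(x, y) = |1 - x ȳ|` with `x ȳ = ∑ i, x i * conj (y i)`
(Mathlib's inner product is conjugate-linear in its first argument). -/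
def nd (x y : Cn n) : ℝ := ‖1 - inner ℂ y x‖

/-- `d(z, E) = inf_{y ∈ E} d(z, y)`, equal to `∞` for `E = ∅`. -/
def ndSet (z : Cn n) (E : Set (Cn n)) : ℝ≥0∞ := ⨅ y ∈ E, ENNReal.ofReal (nd z y)

/-- The ball `B(x, R)` in the space `X`, where `X` is the sphere, the closed ball, or a subset. -/
def nball (X : Set (Cn n)) (x : Cn n) (R : ℝ) : Set (Cn n) := {z ∈ X | nd z x < R}

/-- The neighbourhood `E_ε = {z ∈ X : d(z, E) < ε}` of `E` in the space `X`. -/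
def nbhd (X E : Set (Cn n)) (ε : ℝ) : Set (Cn n) := {z ∈ X | ndSet z E < ENNReal.ofReal ε}

/-- `N(x, R, k)` for the space `(E, d)`: the largest number of points of `E` in `B(x, kR)` at
mutual distance at least `R`. -/
def packing (E : Set (Cn n)) (x : Cn n) (R k : ℝ) : ℕ∞ :=
  ⨆ (t : Finset (Cn n)) (_ : (t : Set (Cn n)) ⊆ nball E x (k * R))
    (_ : (t : Set (Cn n)).Pairwise fun y z => R ≤ nd y z), (t.card : ℕ∞)

/-- `(E, d) ∈ Υ_γ`. -/
def InUpsilon (E : Set (Cn n)) (γ : ℝ) : Prop :=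
  ∃ C : ℝ, 0 < C ∧ ∀ x ∈ E, ∀ R k : ℝ, 0 < R → R ≤ k * R → k * R ≤ 1 →
    (packing E x R k : ℝ≥0∞) ≤ ENNReal.ofReal (C * k ^ γ)

/-- The upper dimension `Υ(E) = inf {γ : (E, d) ∈ Υ_γ}`, an extended real number. -/
def upperDim (E : Set (Cn n)) : EReal := ⨅ (γ : ℝ) (_ : InUpsilon E γ), (γ : EReal)

/-- The Uniform Hole Condition with respect to `(S, d)`. Radii range up to `2`, the `d`-diameter
of `S`, since `d(y, E) ≤ 2` for `E ≠ ∅` rules the bound out for arbitrarily large radii. -/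
def UHC (E : Set (Cn n)) : Prop :=
  ∃ C : ℝ, 0 < C ∧ C < 1 ∧ ∀ x ∈ S n, ∀ r : ℝ, 0 < r → r ≤ 2 →
    ENNReal.ofReal (C * r) ≤ ⨆ y ∈ nball (S n) x r, ndSet y E

/-- The condition `Σ_s`. -/
def SigmaCond (E : Set (Cn n)) (s : ℝ) : Prop :=
  ∃ C : ℝ, 0 < C ∧ ∀ x ∈ S n, ∀ R ε : ℝ, 0 < ε → ε < R →
    sigma n (nball (S n) x R ∩ nbhd (S n) E ε) ≤ ENNReal.ofReal (C * R ^ s * ε ^ ((n : ℝ) - s))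

/-- The integral over `A` of an extended-real function: the integral of the positive part minus
the integral of the negative part. -/
def eintegral (μ : Measure (Cn n)) (A : Set (Cn n)) (f : Cn n → EReal) : EReal :=
  ((∫⁻ z in A, (f z).toENNReal ∂μ : ℝ≥0∞) : EReal) -
    ((∫⁻ z in A, (-f z).toENNReal ∂μ : ℝ≥0∞) : EReal)

/-- The bound `∫_{B(x,R)} d(z,E)^{-a} dσ(z) ≤ C R^{n-a}` for some `a > 0`. -/
def PowerIntegralBound (E : Set (Cn n)) : Prop :=
  ∃ a C : ℝ, 0 < a ∧ 0 < C ∧ ∀ x ∈ S n, ∀ R : ℝ, 0 < R →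
    ∫⁻ z in nball (S n) x R, ndSet z E ^ (-a) ∂(sigma n) ≤ ENNReal.ofReal (C * R ^ ((n : ℝ) - a))

/-- The bound `∫_{B(x,R)} log(d(z,E)⁻¹) dσ(z) ≤ σ(B(x,R)) log(1/R) + C Rⁿ`, where the integrand
is `+∞` on `E`. -/
def LogIntegralBound (E : Set (Cn n)) : Prop :=
  ∃ C : ℝ, 0 < C ∧ ∀ x ∈ S n, ∀ R : ℝ, 0 < R →
    eintegral (sigma n) (nball (S n) x R) (fun z => ENNReal.log (ndSet z E)⁻¹) ≤
      (((sigma n).real (nball (S n) x R) * Real.log (1 / R) + C * R ^ n : ℝ) : EReal)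

/-- The bound `∫_0^R N(x, δ, R/δ) δ^{n-a} dδ/δ ≤ C R^{n-a}` for some `0 < a < n`. -/
def PackingIntegralBound (E : Set (Cn n)) : Prop :=
  ∃ a C : ℝ, 0 < a ∧ a < n ∧ 0 < C ∧ ∀ x ∈ E, ∀ R : ℝ, 0 < R →
    ∫⁻ δ in Set.Ioo 0 R, (packing E x δ (R / δ) : ℝ≥0∞) * ENNReal.ofReal (δ ^ ((n : ℝ) - a) / δ) ≤
      ENNReal.ofReal (C * R ^ ((n : ℝ) - a))

/-- The volume bound `V(B(x,R) ∩ E_ε) ≤ C R^s ε^{n+1-s}` in the closed ball, for some `s < n`. -/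
def VolumeBound (E : Set (Cn n)) : Prop :=
  ∃ s C : ℝ, s < n ∧ 0 < C ∧ ∀ x ∈ E, ∀ R ε : ℝ, 0 < ε → ε < R →
    V n (nball (clB n) x R ∩ nbhd (clB n) E ε) ≤
      ENNReal.ofReal (C * R ^ s * ε ^ ((n : ℝ) + 1 - s))

/-- For some `a₀ > 1`, the bounds `∫_{B(x,R)} d(z,E)^{-a} dV(z) ≤ C(a) R^{n+1-a}` in the closed
ball, for all `0 ≤ a < a₀`. -/
def VolumeIntegralBound (E : Set (Cn n)) : Prop :=
  ∃ a₀ : ℝ, 1 < a₀ ∧ ∀ a : ℝ, 0 ≤ a → a < a₀ → ∃ C : ℝ, 0 < C ∧ ∀ x ∈ S n, ∀ R : ℝ, 0 < R →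
    ∫⁻ z in nball (clB n) x R, ndSet z E ^ (-a) ∂(V n) ≤
      ENNReal.ofReal (C * R ^ ((n : ℝ) + 1 - a))

end

end NonIso

/-!
On the closed ball `d` is symmetric and satisfies the triangle inequality up to a factor `3`, and
`σ` and `V` are Ahlfors regular for `d` at the points of the sphere, of dimensions `n` and `n + 1`.
Hence counting separated points of `E` in a ball amounts to measuring the neighbourhoods `E_ε`:
balls around a maximal separated set cover `E_ε`, and smaller balls around separated points are
disjoint and lie in `E_ε`. A dyadic decomposition of the values of `d(·, E)` turns measure bounds
into bounds for the integrals of `d(·, E) ^ (-a)`, and Markov's inequality goes back. The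
logarithmic bound follows from `log u ≤ u ^ a / a` with `u = R / d(z, E)`; it forces holes, because
on a ball without holes `log (1 / d(·, E))` exceeds `log (1 / R)` everywhere by a large constant.

The heart of the matter is that holes lower the dimension. Around `E`, the holes of size `r` fill a
fixed proportion of the set where `d(·, E)` is comparable to `r`. For the scales `R, R/L, …,
R/L ^ (J - 1)` these sets are disjoint in a ball of measure `O(R ^ n)`, so one of them has measure
`O(R ^ n / J)`, and a ball of radius `R` contains at most `(B / J) * (L ^ J) ^ n` points of `E`
separated by `R / L ^ J`. Choosing `J > 2 * B` gains a factor `2` over the trivial count, and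
iterating this yields the exponent `n - log 2 / log (L ^ J) < n`.
-/

open scoped Pointwise

namespace NonIso

variable {n : ℕ} {E X : Set (Cn n)} {μ : Measure (Cn n)}

section Distance

theorem nd_nonneg (x y : Cn n) : 0 ≤ nd x y := norm_nonneg _

theorem nd_comm (x y : Cn n) : nd x y = nd y x := by
  rw [nd, nd, ← RCLike.norm_conj, map_sub, map_one, inner_conj_symm]

theorem norm_eq_one_of_mem_S {x : Cn n} (hx : x ∈ S n) : ‖x‖ = 1 := mem_sphere_zero_iff_norm.mp hx

theorem norm_le_one_of_mem_clB {x : Cn n} (hx : x ∈ clB n) : ‖x‖ ≤ 1 :=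
  mem_closedBall_zero_iff.mp hx

theorem S_subset_clB : S n ⊆ clB n := Metric.sphere_subset_closedBall

theorem pos_of_mem_S {x : Cn n} (hx : x ∈ S n) : 0 < n := by
  rcases n.eq_zero_or_pos with rfl | hn
  · simpa [Subsingleton.elim x 0] using norm_eq_one_of_mem_S hx
  · exact hn

theorem inner_self_eq_one_of_mem_S {x : Cn n} (hx : x ∈ S n) : inner ℂ x x = (1 : ℂ) := by
  rw [inner_self_eq_norm_sq_to_K, norm_eq_one_of_mem_S hx, RCLike.ofReal_one, one_pow]

theorem nd_self {x : Cn n} (hx : x ∈ S n) : nd x x = 0 := by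
  rw [nd, inner_self_eq_one_of_mem_S hx, sub_self, norm_zero]

theorem norm_inner_le_norm_of_mem_clB {x : Cn n} (hx : x ∈ clB n) (y : Cn n) :
    ‖inner ℂ y x‖ ≤ ‖y‖ :=
  (norm_inner_le_norm y x).trans
    (mul_le_of_le_one_right (norm_nonneg _) (norm_le_one_of_mem_clB hx))

theorem one_sub_norm_le_nd {x : Cn n} (hx : x ∈ clB n) (y : Cn n) : 1 - ‖y‖ ≤ nd x y := by
  have h := norm_sub_norm_le (1 : ℂ) (inner ℂ y x)
  rw [norm_one] at h
  exact (sub_le_sub_left (norm_inner_le_norm_of_mem_clB hx y) 1).trans h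

theorem nd_le_norm_sub {y : Cn n} (hy : y ∈ S n) (z : Cn n) : nd z y ≤ ‖z - y‖ := by
  have h : (1 : ℂ) - inner ℂ y z = inner ℂ y (y - z) := by
    rw [inner_sub_right, inner_self_eq_one_of_mem_S hy]
  rw [nd, h, norm_sub_rev]
  simpa only [norm_eq_one_of_mem_S hy, one_mul] using norm_inner_le_norm (𝕜 := ℂ) y (y - z)

theorem norm_sub_sq_le_nd {x y : Cn n} (hx : x ∈ clB n) (hy : y ∈ clB n) :
    ‖x - y‖ ^ 2 ≤ 2 * nd x y := by
  have hre : 1 - RCLike.re (inner ℂ y x : ℂ) ≤ nd x y := by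
    simpa [nd] using RCLike.re_le_norm (1 - inner ℂ y x : ℂ)
  rw [norm_sub_rev, norm_sub_sq (𝕜 := ℂ) y x]
  nlinarith [norm_nonneg x, norm_nonneg y, norm_le_one_of_mem_clB hx, norm_le_one_of_mem_clB hy]

theorem norm_one_sub_inner_self_le {x y : Cn n} (hx : x ∈ clB n) (hy : y ∈ clB n) :
    ‖(1 : ℂ) - inner ℂ y y‖ ≤ 2 * nd x y := by
  have h : (1 : ℂ) - inner ℂ y y = ((1 - ‖y‖ ^ 2 : ℝ) : ℂ) := by
    rw [inner_self_eq_norm_sq_to_K]; push_cast; rfl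
  have hy1 := norm_le_one_of_mem_clB hy
  rw [h, Complex.norm_real, Real.norm_eq_abs, abs_of_nonneg (by nlinarith [norm_nonneg y])]
  nlinarith [norm_nonneg y, one_sub_norm_le_nd hx y]

theorem nd_triangle {x y z : Cn n} (hx : x ∈ clB n) (hy : y ∈ clB n) (hz : z ∈ clB n) :
    nd x z ≤ 3 * (nd x y + nd y z) := by
  have hdecomp : (1 : ℂ) - inner ℂ z x =
      (1 - inner ℂ y x) + (1 - inner ℂ z y) - (1 - inner ℂ y y) - inner ℂ (z - y) (x - y) := by
    simp only [inner_sub_left, inner_sub_right]; ring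
  have hself : ‖(1 : ℂ) - inner ℂ y y‖ ≤ nd x y + nd y z := by
    have h₁ := norm_one_sub_inner_self_le hx hy
    have h₂ := norm_one_sub_inner_self_le hz hy
    rw [nd_comm z y] at h₂
    linarith
  have hcross : ‖(inner ℂ (z - y) (x - y) : ℂ)‖ ≤ nd x y + nd y z := by
    have h₁ := norm_sub_sq_le_nd hx hy
    have h₂ := norm_sub_sq_le_nd hz hy
    rw [nd_comm z y] at h₂
    nlinarith [norm_inner_le_norm (𝕜 := ℂ) (z - y) (x - y), sq_nonneg (‖z - y‖ - ‖x - y‖)]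
  calc nd x z
      ≤ nd x y + nd y z + ‖(1 : ℂ) - inner ℂ y y‖ + ‖(inner ℂ (z - y) (x - y) : ℂ)‖ := by
        rw [nd, hdecomp]
        refine (norm_sub_le _ _).trans (add_le_add_left ((norm_sub_le _ _).trans ?_) _)
        exact add_le_add_left (norm_add_le _ _) _
    _ ≤ 3 * (nd x y + nd y z) := by linarith

theorem nball_subset_nball (hX : X ⊆ clB n) {x y : Cn n} (hx : x ∈ clB n) (hy : y ∈ clB n) (ρ : ℝ) :
    nball X y ρ ⊆ nball X x (3 * (ρ + nd y x)) := fun z hz =>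
  ⟨hz.1, (nd_triangle (hX hz.1) hy hx).trans_lt (by linarith [hz.2])⟩

theorem nball_mono {X Y : Set (Cn n)} (h : X ⊆ Y) (x : Cn n) {r s : ℝ} (hrs : r ≤ s) :
    nball X x r ⊆ nball Y x s := fun _ hz => ⟨h hz.1, hz.2.trans_le hrs⟩

@[fun_prop]
theorem continuous_nd_left (y : Cn n) : Continuous fun z => nd z y := by
  unfold nd; fun_prop

theorem measurable_ndSet (E : Set (Cn n)) : Measurable fun z => ndSet z E :=
  UpperSemicontinuous.measurable <| upperSemicontinuous_biInf fun y _ =>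
    (ENNReal.continuous_ofReal.comp (continuous_nd_left y)).upperSemicontinuous

theorem ndSet_lt_ofReal_iff {z : Cn n} {ε : ℝ} :
    ndSet z E < ENNReal.ofReal ε ↔ ∃ y ∈ E, nd z y < ε := by
  simp only [ndSet, iInf_lt_iff, exists_prop,
    ENNReal.ofReal_lt_ofReal_iff_of_nonneg (nd_nonneg _ _)]

theorem ofReal_le_ndSet_iff {z : Cn n} {ε : ℝ} :
    ENNReal.ofReal ε ≤ ndSet z E ↔ ∀ y ∈ E, ε ≤ nd z y := by
  rw [← not_lt, ndSet_lt_ofReal_iff]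
  push Not
  rfl

theorem measurableSet_nball (hX : MeasurableSet X) (x : Cn n) (R : ℝ) :
    MeasurableSet (nball X x R) :=
  hX.inter ((continuous_nd_left x).measurable measurableSet_Iio)

theorem measurableSet_S : MeasurableSet (S n) := Metric.isClosed_sphere.measurableSet

theorem measurableSet_clB : MeasurableSet (clB n) := Metric.isClosed_closedBall.measurableSet

end Distance

/-- The measure `μ` on the space `X` makes balls centred on the sphere Ahlfors `m`-regular for `d`.
It applies to `σ` on the sphere with `m = n` and to `V` on the closed ball with `m = n + 1`. -/
structure Regular (X : Set (Cn n)) (μ : Measure (Cn n)) (m : ℝ) : Prop where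
  subset_clB : X ⊆ clB n
  measurableSet : MeasurableSet X
  exists_le_measure_nball : ∃ c : ℝ, 0 < c ∧ ∀ x ∈ S n, ∀ r : ℝ, 0 < r → r ≤ 2 →
    ENNReal.ofReal (c * r ^ m) ≤ μ (nball X x r)
  exists_measure_nball_le : ∃ C : ℝ, 0 < C ∧ ∀ x ∈ S n, ∀ r : ℝ, 0 < r →
    μ (nball X x r) ≤ ENNReal.ofReal (C * r ^ m)

section Volume

/-- The open polydisc with centre `w` and polyradius `r`. -/
def polydisc (w : Fin n → ℂ) (r : Fin n → ℝ) : Set (Cn n) := {z | ∀ i, ‖z i - w i‖ < r i}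

theorem measurableSet_polydisc (w : Fin n → ℂ) (r : Fin n → ℝ) :
    MeasurableSet (polydisc w r) := by
  rw [polydisc, Set.ofPred_forall]
  exact MeasurableSet.iInter fun i => measurableSet_lt (by fun_prop) (by fun_prop)

theorem volume_univ_pi_ball (w : Fin n → ℂ) {r : Fin n → ℝ} (hr : ∀ i, 0 ≤ r i) :
    volume (Set.univ.pi fun i => Metric.ball (w i) (r i)) =
      ENNReal.ofReal (Real.pi ^ n * ∏ i, r i ^ 2) := by
  have hball : ∀ i, volume (Metric.ball (w i) (r i)) = ENNReal.ofReal (Real.pi * r i ^ 2) :=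
    fun i => by
      rw [Complex.volume_ball, ← ENNReal.ofReal_coe_nnreal (p := NNReal.pi), NNReal.coe_real_pi,
        ← ENNReal.ofReal_pow (hr i), mul_comm, ENNReal.ofReal_mul Real.pi_pos.le]
  simp only [volume_pi_pi, hball]
  rw [← ENNReal.ofReal_prod_of_nonneg fun i _ => by positivity, Finset.prod_mul_distrib,
    Finset.prod_const, Finset.card_fin]

theorem exists_volume_polydisc (n : ℕ) : ∃ c : ℝ, 0 < c ∧ ∀ (w : Fin n → ℂ) (r : Fin n → ℝ),
    (∀ i, 0 ≤ r i) → volume (polydisc w r) = ENNReal.ofReal (c * ∏ i, r i ^ 2) := by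
  let L := (PiLp.continuousLinearEquiv 2 ℝ fun _ : Fin n => ℂ).symm
  have : ((volume : Measure (Fin n → ℂ)).map L).IsAddHaarMeasure := L.isAddHaarMeasure_map _
  obtain ⟨c, hc⟩ : ∃ c : NNReal, (volume : Measure (Cn n)) = c • volume.map L :=
    ⟨_, Measure.isAddLeftInvariant_eq_smul _ _⟩
  have hc0 : c ≠ 0 := by
    rintro rfl
    exact NeZero.ne (volume : Measure (Cn n)) (hc.trans (zero_smul _ _))
  refine ⟨c * Real.pi ^ n, by positivity, fun w r hr => ?_⟩
  have hpre : L ⁻¹' polydisc w r = Set.univ.pi fun i => Metric.ball (w i) (r i) := by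
    ext z
    simp [L, polydisc, Set.mem_pi, dist_eq_norm]
  rw [hc, Measure.smul_apply, Measure.map_apply L.continuous.measurable
    (measurableSet_polydisc w r), hpre, volume_univ_pi_ball w hr, mul_assoc,
    ENNReal.ofReal_mul c.coe_nonneg, ENNReal.smul_def, smul_eq_mul, ENNReal.ofReal_coe_nnreal]

theorem exists_isometry_apply_eq_single {m : ℕ} {x : Cn (m + 1)} (hx : x ∈ S (m + 1)) :
    ∃ U : Cn (m + 1) ≃ₗᵢ[ℂ] Cn (m + 1), U x = EuclideanSpace.single 0 1 := by
  have hortho : Orthonormal ℂ (({0} : Set (Fin (m + 1))).domRestrict fun _ => x) := by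
    rw [orthonormal_iff_ite]
    rintro ⟨i, rfl⟩ ⟨j, rfl⟩
    simpa using inner_self_eq_one_of_mem_S hx
  obtain ⟨b, hb⟩ := hortho.exists_orthonormalBasis_extension_of_card_eq (by simp)
  exact ⟨b.repr, by rw [← hb 0 rfl, b.repr_self]⟩

theorem measurePreserving_complexIsometry (U : Cn n ≃ₗᵢ[ℂ] Cn n) :
    MeasurePreserving U volume volume :=
  (LinearIsometryEquiv.measurePreserving
    { U.toLinearEquiv.restrictScalars ℝ with norm_map' := U.norm_map } :)

theorem V_nball_apply_isometry (U : Cn n ≃ₗᵢ[ℂ] Cn n) (x : Cn n) (r : ℝ) :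
    V n (nball (clB n) (U x) r) = V n (nball (clB n) x r) := by
  rw [V, Measure.restrict_eq_self _ fun z hz => hz.1, Measure.restrict_eq_self _ fun z hz => hz.1,
    ← (measurePreserving_complexIsometry U).measure_preimage
      (measurableSet_nball measurableSet_clB (U x) r).nullMeasurableSet]
  congr 1
  ext z
  simp [nball, nd]

theorem V_nball_eq_volume {m : ℕ} {x : Cn (m + 1)} (hx : x ∈ S (m + 1)) (r : ℝ) :
    V (m + 1) (nball (clB (m + 1)) x r) =
      volume {z : Cn (m + 1) | ‖z‖ ≤ 1 ∧ ‖1 - z 0‖ < r} := by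
  obtain ⟨U, hU⟩ := exists_isometry_apply_eq_single hx
  rw [← V_nball_apply_isometry U, hU, V, Measure.restrict_eq_self _ fun z hz => hz.1]
  congr 1
  ext z
  simp [nball, nd, EuclideanSpace.inner_single_left]

theorem norm_sq_eq_add_sum_succ {m : ℕ} (z : Cn (m + 1)) :
    ‖z‖ ^ 2 = ‖z 0‖ ^ 2 + ∑ i : Fin m, ‖z i.succ‖ ^ 2 := by
  rw [EuclideanSpace.norm_sq_eq, Fin.sum_univ_succ]

theorem polydisc_subset_cap {m : ℕ} {r : ℝ} (hr : 0 < r) (hr2 : r ≤ 2) :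
    polydisc (Fin.cons ((1 - r / 4 : ℝ) : ℂ) 0) (Fin.cons (r / 8) fun _ => √(r / (8 * (m + 1)))) ⊆
      {z : Cn (m + 1) | ‖z‖ ≤ 1 ∧ ‖1 - z 0‖ < r} := by
  intro z hz
  have hz₀ : ‖z 0 - ((1 - r / 4 : ℝ) : ℂ)‖ < r / 8 := by simpa using hz 0
  have hzi : ∀ i : Fin m, ‖z i.succ‖ ^ 2 ≤ r / (8 * (m + 1)) := fun i =>
    (Real.lt_sqrt (norm_nonneg _)).mp (by simpa using hz i.succ) |>.le
  have htail : ∑ i : Fin m, ‖z i.succ‖ ^ 2 ≤ r / 8 := by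
    refine (Finset.sum_le_card_nsmul _ _ _ fun i _ => hzi i).trans ?_
    rw [Finset.card_fin, nsmul_eq_mul, mul_div_assoc',
      div_le_div_iff₀ (by positivity) (by norm_num)]
    nlinarith
  have hhead : ‖z 0‖ ≤ 1 - r / 8 := by
    have := norm_sub_norm_le (z 0) ((1 - r / 4 : ℝ) : ℂ)
    rw [Complex.norm_real, Real.norm_eq_abs, abs_of_nonneg (by linarith)] at this
    linarith
  constructor
  · nlinarith [norm_sq_eq_add_sum_succ z, norm_nonneg z, norm_nonneg (z 0)]
  · calc ‖1 - z 0‖ = ‖((r / 4 : ℝ) : ℂ) - (z 0 - ((1 - r / 4 : ℝ) : ℂ))‖ := by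
          push_cast; ring_nf
      _ ≤ r / 4 + ‖z 0 - ((1 - r / 4 : ℝ) : ℂ)‖ := by
          refine (norm_sub_le _ _).trans_eq ?_
          rw [Complex.norm_real, Real.norm_eq_abs, abs_of_nonneg (by linarith)]
      _ < r := by linarith

theorem cap_subset_polydisc {m : ℕ} (r : ℝ) :
    {z : Cn (m + 1) | ‖z‖ ≤ 1 ∧ ‖1 - z 0‖ < r} ⊆
      polydisc (Fin.cons 1 0) (Fin.cons r fun _ => √(2 * r)) := by
  rintro z ⟨hz, hzr⟩ i
  refine Fin.cases (by simpa [norm_sub_rev] using hzr) (fun i => ?_) i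
  have hhead : 1 - ‖z 0‖ < r := by
    have := norm_sub_norm_le 1 (z 0)
    rw [norm_one] at this
    linarith
  have htail : ‖z i.succ‖ ^ 2 ≤ ∑ i : Fin m, ‖z i.succ‖ ^ 2 :=
    Finset.single_le_sum (f := fun i : Fin m => ‖z i.succ‖ ^ 2) (fun _ _ => by positivity)
      (Finset.mem_univ i)
  simp only [Fin.cons_succ, Pi.zero_apply, sub_zero]
  apply Real.lt_sqrt_of_sq_lt
  nlinarith [norm_sq_eq_add_sum_succ z, norm_nonneg z, norm_nonneg (z 0),
    (PiLp.norm_apply_le z 0).trans hz]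

theorem regular_V (n : ℕ) : Regular (clB n) (V n) (n + 1) := by
  rcases n with - | m
  · exact ⟨subset_rfl, measurableSet_clB,
      ⟨1, one_pos, fun x hx => absurd (pos_of_mem_S hx) (lt_irrefl 0)⟩,
      ⟨1, one_pos, fun x hx => absurd (pos_of_mem_S hx) (lt_irrefl 0)⟩⟩
  obtain ⟨c, hc, hvol⟩ := exists_volume_polydisc (m + 1)
  have hpow : ∀ r : ℝ, r ^ (((m + 1 : ℕ) : ℝ) + 1) = r ^ 2 * r ^ m := fun r => by
    rw [← Nat.cast_add_one, Real.rpow_natCast]; ring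
  refine ⟨subset_rfl, measurableSet_clB,
    ⟨c * (1 / 64 * (1 / (8 * (m + 1))) ^ m), by positivity, fun x hx r hr hr2 => ?_⟩,
    ⟨c * 2 ^ m, by positivity, fun x hx r hr => ?_⟩⟩ <;> rw [V_nball_eq_volume hx]
  · refine le_of_eq_of_le ?_ (measure_mono (polydisc_subset_cap hr hr2))
    rw [hvol _ _ (Fin.cases (by rw [Fin.cons_zero]; positivity) fun i => by simp),
      Fin.prod_univ_succ]
    simp only [Fin.cons_zero, Fin.cons_succ, Finset.prod_const, Finset.card_fin]
    rw [Real.sq_sqrt (by positivity), hpow, div_pow r, div_pow 1, one_pow]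
    congr 1
    ring
  · refine (measure_mono (cap_subset_polydisc r)).trans_eq ?_
    rw [hvol _ _ (Fin.cases (by simpa using hr.le) fun i => by simp), Fin.prod_univ_succ]
    simp only [Fin.cons_zero, Fin.cons_succ, Finset.prod_const, Finset.card_fin]
    rw [Real.sq_sqrt (by positivity), hpow]
    congr 1
    ring

end Volume

section Sector

variable {F : Type*} [NormedAddCommGroup F] [NormedSpace ℝ F]

theorem mem_smul_iff_of_subset_sphere {I : Set ℝ} {A : Set F} (hI : I ⊆ Set.Ioi 0)
    (hA : A ⊆ Metric.sphere 0 1) {z : F} : z ∈ I • A ↔ ‖z‖ ∈ I ∧ ‖z‖⁻¹ • z ∈ A := by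
  constructor
  · rintro ⟨ρ, hρ, y, hy, rfl⟩
    have hρ0 : 0 < ρ := hI hρ
    have hnorm : ‖ρ • y‖ = ρ := by
      rw [norm_smul, mem_sphere_zero_iff_norm.mp (hA hy), mul_one, Real.norm_of_nonneg hρ0.le]
    simpa only [hnorm, inv_smul_smul₀ hρ0.ne'] using ⟨hρ, hy⟩
  · rintro ⟨hz, hzA⟩
    exact ⟨‖z‖, hz, _, hzA, smul_inv_smul₀ (hI hz).ne' z⟩

variable [MeasurableSpace F] [BorelSpace F]

theorem measurableSet_smul_of_subset_sphere {I : Set ℝ} {A : Set F} (hI : I ⊆ Set.Ioi 0)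
    (hIm : MeasurableSet I) (hA : A ⊆ Metric.sphere 0 1) (hAm : MeasurableSet A) :
    MeasurableSet (I • A) := by
  have hset : I • A = (fun z => ‖z‖) ⁻¹' I ∩ (fun z => ‖z‖⁻¹ • z) ⁻¹' A :=
    Set.ext fun _ => mem_smul_iff_of_subset_sphere hI hA
  rw [hset]
  exact (measurable_norm hIm).inter ((measurable_norm.inv.smul measurable_id) hAm)

theorem measure_Ico_smul [FiniteDimensional ℝ F] (μ : Measure F) [μ.IsAddHaarMeasure] {A : Set F}
    (hA : A ⊆ Metric.sphere 0 1) (hAm : MeasurableSet A) {t : ℝ} (ht : 0 < t) (ht1 : t ≤ 1) :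
    μ (Set.Ico t 1 • A) =
      ENNReal.ofReal (1 - t ^ Module.finrank ℝ F) * μ (Set.Ioo (0 : ℝ) 1 • A) := by
  have hpos : Set.Ioo 0 t ⊆ Set.Ioi 0 := Set.Ioo_subset_Ioi_self
  have hscale : μ (Set.Ioo 0 t • A) =
      ENNReal.ofReal (t ^ Module.finrank ℝ F) * μ (Set.Ioo (0 : ℝ) 1 • A) := by
    have h : Set.Ioo 0 t • A = t • (Set.Ioo (0 : ℝ) 1 • A) := by
      rw [← smul_assoc, LinearOrderedField.smul_Ioo ht, mul_zero, mul_one]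
    rw [h, Measure.addHaar_smul, abs_of_nonneg (by positivity)]
  have hdisj : Disjoint (Set.Ioo 0 t • A) (Set.Ico t 1 • A) := by
    refine Set.disjoint_left.mpr fun z hz hz' => ?_
    rw [mem_smul_iff_of_subset_sphere hpos hA] at hz
    rw [mem_smul_iff_of_subset_sphere (fun s hs => ht.trans_le hs.1) hA] at hz'
    exact hz'.1.1.not_gt hz.1.2
  have hfin : μ (Set.Ioo 0 t • A) ≠ ∞ := by
    refine ((measure_mono fun z hz => ?_).trans_lt (measure_ball_lt_top (x := 0) (r := t))).ne
    rw [mem_smul_iff_of_subset_sphere hpos hA] at hz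
    exact mem_ball_zero_iff.mpr hz.1.2
  rw [← ENNReal.add_right_inj hfin, ← measure_union' hdisj
    (measurableSet_smul_of_subset_sphere hpos measurableSet_Ioo hA hAm), ← Set.union_smul,
    Set.Ioo_union_Ico_eq_Ioo ht ht1, hscale, ← add_mul, ← ENNReal.ofReal_add (by positivity)
    (sub_nonneg.mpr (pow_le_one₀ ht.le ht1)), add_sub_cancel, ENNReal.ofReal_one, one_mul]

end Sector

section Surface

theorem finrank_real_Cn (n : ℕ) : Module.finrank ℝ (Cn n) = 2 * n := by
  rw [← Module.finrank_mul_finrank ℝ ℂ (Cn n), Complex.finrank_real_complex, finrank_euclideanSpace,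
    Fintype.card_fin]

theorem nontrivial_Cn (hn : 0 < n) : Nontrivial (Cn n) :=
  Module.nontrivial_of_finrank_pos (R := ℝ) (by rw [finrank_real_Cn]; omega)

theorem sigma_le_one (A : Set (Cn n)) : sigma n A ≤ 1 := by
  refine (measure_mono (Set.subset_univ A)).trans ?_
  rw [sigma, Measure.smul_apply, Measure.map_apply measurable_subtype_coe MeasurableSet.univ,
    Set.preimage_univ, smul_eq_mul]
  exact ENNReal.inv_mul_le_one _

theorem volume_Ioo_smul (hn : 0 < n) {A : Set (Cn n)} (hA : A ⊆ S n) (hAm : MeasurableSet A) :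
    volume (Set.Ioo (0 : ℝ) 1 • A) = volume (Metric.ball (0 : Cn n) 1) * sigma n A := by
  have hdim : (Module.finrank ℝ (Cn n) : ℝ≥0∞) ≠ 0 := by
    rw [finrank_real_Cn]; exact_mod_cast (by omega : 2 * n ≠ 0)
  have hball : volume (Metric.ball (0 : Cn n) 1) ≠ 0 := (Metric.measure_ball_pos _ _ one_pos).ne'
  rw [sigma, Measure.smul_apply, Measure.map_apply measurable_subtype_coe hAm,
    Measure.toSphere_apply' _ (measurable_subtype_coe hAm), Measure.toSphere_apply_univ,
    Subtype.image_preimage_coe, Set.inter_eq_right.mpr hA, smul_eq_mul,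
    ENNReal.mul_inv (Or.inl hdim) (Or.inl (by simp)), mul_mul_mul_comm,
    ENNReal.inv_mul_cancel hdim (by simp), one_mul, ← mul_assoc,
    ENNReal.mul_inv_cancel hball measure_ball_lt_top.ne, one_mul]

theorem volume_Ico_smul_nball {x : Cn n} (hx : x ∈ S n) (r : ℝ) {t : ℝ} (ht : 0 < t)
    (ht1 : t ≤ 1) :
    volume (Set.Ico t 1 • nball (S n) x r) = ENNReal.ofReal (1 - t ^ (2 * n)) *
      (volume (Metric.ball (0 : Cn n) 1) * sigma n (nball (S n) x r)) := by
  have hA : nball (S n) x r ⊆ S n := fun z hz => hz.1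
  have hAm := measurableSet_nball measurableSet_S x r
  rw [measure_Ico_smul volume hA hAm ht ht1, volume_Ioo_smul (pos_of_mem_S hx) hA hAm,
    finrank_real_Cn]

theorem one_sub_inner_smul (x y : Cn n) (ρ : ℝ) :
    (1 : ℂ) - inner ℂ x (ρ • y) = (1 - inner ℂ x y) + ((1 - ρ : ℝ) : ℂ) * inner ℂ x y := by
  rw [inner_smul_right_eq_smul, Complex.real_smul]; push_cast; ring

theorem norm_one_sub_mul_inner_le {x y : Cn n} (hx : x ∈ S n) (hy : y ∈ S n) {ρ : ℝ}
    (hρ : ρ ≤ 1) : ‖((1 - ρ : ℝ) : ℂ) * inner ℂ x y‖ ≤ 1 - ρ := by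
  rw [norm_mul, Complex.norm_real, Real.norm_of_nonneg (by linarith)]
  refine mul_le_of_le_one_right (by linarith) ?_
  exact (norm_inner_le_norm_of_mem_clB (S_subset_clB hy) x).trans_eq (norm_eq_one_of_mem_S hx)

theorem nd_smul_le_add {x y : Cn n} (hx : x ∈ S n) (hy : y ∈ S n) {ρ : ℝ} (hρ : ρ ≤ 1) :
    nd (ρ • y) x ≤ nd y x + (1 - ρ) := by
  rw [nd, one_sub_inner_smul]
  exact (norm_add_le _ _).trans (add_le_add_right (norm_one_sub_mul_inner_le hx hy hρ) _)

theorem nd_le_two_mul_nd_smul {x y : Cn n} (hx : x ∈ S n) (hy : y ∈ S n) {ρ : ℝ} (hρ : 0 ≤ ρ)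
    (hρ1 : ρ ≤ 1) : nd y x ≤ 2 * nd (ρ • y) x := by
  have hradial : 1 - ρ ≤ nd (ρ • y) x := by
    have h := one_sub_norm_le_nd (S_subset_clB hx) (ρ • y)
    rwa [norm_smul, norm_eq_one_of_mem_S hy, Real.norm_of_nonneg hρ, mul_one, nd_comm] at h
  have htangential : nd y x ≤ nd (ρ • y) x + (1 - ρ) := by
    rw [nd, nd, eq_sub_of_add_eq (one_sub_inner_smul x y ρ).symm]
    exact (norm_sub_le _ _).trans (add_le_add_right (norm_one_sub_mul_inner_le hx hy hρ1) _)
  linarith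

theorem inv_norm_smul_mem_S {z : Cn n} (hz : 0 < ‖z‖) : ‖z‖⁻¹ • z ∈ S n := by
  rw [mem_sphere_zero_iff_norm, norm_smul, norm_inv, norm_norm, inv_mul_cancel₀ hz.ne']

theorem nball_clB_subset_Ico_smul {x : Cn n} (hx : x ∈ S n) {ρ : ℝ} (hρ : ρ < 1) :
    nball (clB n) x ρ ⊆ (Set.Ico (1 - ρ) 1 • nball (S n) x (2 * ρ)) ∪ S n := by
  rintro z ⟨hz, hzx⟩
  rcases (norm_le_one_of_mem_clB hz).eq_or_lt with hz1 | hz1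
  · exact Or.inr (mem_sphere_zero_iff_norm.mpr hz1)
  have hρz : 1 - ρ < ‖z‖ := by
    have h := one_sub_norm_le_nd (S_subset_clB hx) z
    rw [nd_comm] at h
    linarith
  have hz0 : 0 < ‖z‖ := by linarith
  have hS := inv_norm_smul_mem_S hz0
  refine Or.inl ⟨‖z‖, ⟨hρz.le, hz1⟩, _, ⟨hS, ?_⟩, smul_inv_smul₀ hz0.ne' z⟩
  have h := nd_le_two_mul_nd_smul hx hS hz0.le hz1.le
  rw [smul_inv_smul₀ hz0.ne'] at h
  linarith

theorem Ico_smul_nball_subset {x : Cn n} (hx : x ∈ S n) {ρ : ℝ} (hρ : ρ ≤ 1) :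
    Set.Ico (1 - ρ) 1 • nball (S n) x ρ ⊆ nball (clB n) x (2 * ρ) := by
  rintro _ ⟨s, hs, y, hy, rfl⟩
  have hs0 : 0 ≤ s := by linarith [hs.1]
  refine ⟨?_, by linarith [nd_smul_le_add hx hy.1 hs.2.le, hs.1, hy.2]⟩
  rw [mem_closedBall_zero_iff, norm_smul, norm_eq_one_of_mem_S hy.1, mul_one,
    Real.norm_of_nonneg hs0]
  exact hs.2.le

theorem V_nball_le {x : Cn n} (hx : x ∈ S n) {ρ : ℝ} (hρ : 0 < ρ) (hρ1 : ρ < 1) :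
    V n (nball (clB n) x ρ) ≤ ENNReal.ofReal (2 * n * ρ) *
      (volume (Metric.ball (0 : Cn n) 1) * sigma n (nball (S n) x (2 * ρ))) := by
  have := nontrivial_Cn (pos_of_mem_S hx)
  have hbernoulli : 1 - (1 - ρ) ^ (2 * n) ≤ 2 * n * ρ := by
    have h := one_add_mul_le_pow (a := -ρ) (by linarith) (2 * n)
    rw [← sub_eq_add_neg] at h
    push_cast at h
    linarith
  calc V n (nball (clB n) x ρ)
      = volume (nball (clB n) x ρ) := Measure.restrict_eq_self _ fun z hz => hz.1
    _ ≤ volume (Set.Ico (1 - ρ) 1 • nball (S n) x (2 * ρ)) + volume (S n) :=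
        (measure_mono (nball_clB_subset_Ico_smul hx hρ1)).trans (measure_union_le _ _)
    _ = ENNReal.ofReal (1 - (1 - ρ) ^ (2 * n)) *
          (volume (Metric.ball (0 : Cn n) 1) * sigma n (nball (S n) x (2 * ρ))) := by
        rw [Measure.addHaar_sphere, add_zero,
          volume_Ico_smul_nball hx _ (by linarith) (by linarith)]
    _ ≤ _ := by gcongr

theorem mul_sigma_nball_le {x : Cn n} (hx : x ∈ S n) {ρ : ℝ} (hρ : 0 < ρ) (hρ1 : ρ < 1) :
    ENNReal.ofReal ρ * (volume (Metric.ball (0 : Cn n) 1) * sigma n (nball (S n) x ρ)) ≤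
      V n (nball (clB n) x (2 * ρ)) := by
  have hn := pos_of_mem_S hx
  have hpow : (1 - ρ) ^ (2 * n) ≤ 1 - ρ := pow_le_of_le_one (by linarith) (by linarith) (by omega)
  calc _ ≤ ENNReal.ofReal (1 - (1 - ρ) ^ (2 * n)) *
          (volume (Metric.ball (0 : Cn n) 1) * sigma n (nball (S n) x ρ)) := by
        gcongr; linarith
    _ = volume (Set.Ico (1 - ρ) 1 • nball (S n) x ρ) :=
        (volume_Ico_smul_nball hx _ (by linarith) (by linarith)).symm
    _ ≤ volume (nball (clB n) x (2 * ρ)) := measure_mono (Ico_smul_nball_subset hx hρ1.le)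
    _ = V n (nball (clB n) x (2 * ρ)) := (Measure.restrict_eq_self _ fun z hz => hz.1).symm

theorem exists_volume_ball_eq_ofReal (n : ℕ) :
    ∃ β : ℝ, 0 < β ∧ volume (Metric.ball (0 : Cn n) 1) = ENNReal.ofReal β :=
  ⟨_, ENNReal.toReal_pos (Metric.measure_ball_pos _ _ one_pos).ne' measure_ball_lt_top.ne,
    (ENNReal.ofReal_toReal measure_ball_lt_top.ne).symm⟩

theorem exists_le_sigma_nball (n : ℕ) : ∃ c : ℝ, 0 < c ∧ ∀ x ∈ S n, ∀ r : ℝ, 0 < r → r ≤ 2 →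
    ENNReal.ofReal (c * r ^ (n : ℝ)) ≤ sigma n (nball (S n) x r) := by
  obtain ⟨c, hc, hV⟩ := (regular_V n).exists_le_measure_nball
  obtain ⟨β, hβ, hvol⟩ := exists_volume_ball_eq_ofReal n
  refine ⟨c / ((2 * n + 1) * β * 4 ^ n), by positivity, fun x hx r hr hr2 => ?_⟩
  have hκ : 0 < (2 * n + 1) * (r / 4) * β := by positivity
  refine (ENNReal.mul_le_mul_iff_right (ENNReal.ofReal_pos.mpr hκ).ne' ENNReal.ofReal_ne_top).mp ?_
  calc ENNReal.ofReal ((2 * n + 1) * (r / 4) * β) *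
        ENNReal.ofReal (c / ((2 * n + 1) * β * 4 ^ n) * r ^ (n : ℝ))
      = ENNReal.ofReal (c * (r / 4) ^ ((n : ℝ) + 1)) := by
        rw [← ENNReal.ofReal_mul hκ.le, ← Nat.cast_succ, Real.rpow_natCast, Real.rpow_natCast,
          pow_succ, div_pow]
        congr 1
        field_simp
    _ ≤ V n (nball (clB n) x (r / 4)) := hV x hx _ (by linarith) (by linarith)
    _ ≤ ENNReal.ofReal (2 * n * (r / 4)) *
          (ENNReal.ofReal β * sigma n (nball (S n) x (2 * (r / 4)))) :=
        hvol ▸ V_nball_le hx (by linarith) (by linarith)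
    _ ≤ ENNReal.ofReal ((2 * n + 1) * (r / 4) * β) * sigma n (nball (S n) x r) := by
        rw [← mul_assoc, ← ENNReal.ofReal_mul (by positivity)]
        gcongr
        · linarith
        · exact nball_mono subset_rfl x (by linarith)

theorem exists_sigma_nball_le (n : ℕ) : ∃ C : ℝ, 0 < C ∧ ∀ x ∈ S n, ∀ r : ℝ, 0 < r →
    sigma n (nball (S n) x r) ≤ ENNReal.ofReal (C * r ^ (n : ℝ)) := by
  obtain ⟨C, hC, hV⟩ := (regular_V n).exists_measure_nball_le
  obtain ⟨β, hβ, hvol⟩ := exists_volume_ball_eq_ofReal n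
  refine ⟨max 1 (C * 2 ^ (n + 1) / β), by positivity, fun x hx r hr => ?_⟩
  rcases le_or_gt 1 r with hr1 | hr1
  · refine (sigma_le_one _).trans (ENNReal.one_le_ofReal.mpr ?_)
    exact one_le_mul_of_one_le_of_one_le (le_max_left _ _) (Real.one_le_rpow hr1 n.cast_nonneg)
  have hκ : 0 < r * β := by positivity
  refine (ENNReal.mul_le_mul_iff_right (ENNReal.ofReal_pos.mpr hκ).ne' ENNReal.ofReal_ne_top).mp ?_
  calc ENNReal.ofReal (r * β) * sigma n (nball (S n) x r)
      = ENNReal.ofReal r * (ENNReal.ofReal β * sigma n (nball (S n) x r)) := by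
        rw [ENNReal.ofReal_mul hr.le, mul_assoc]
    _ ≤ V n (nball (clB n) x (2 * r)) := hvol ▸ mul_sigma_nball_le hx hr hr1
    _ ≤ ENNReal.ofReal (C * (2 * r) ^ ((n : ℝ) + 1)) := hV x hx _ (by linarith)
    _ = ENNReal.ofReal (r * β) * ENNReal.ofReal (C * 2 ^ (n + 1) / β * r ^ (n : ℝ)) := by
        rw [← ENNReal.ofReal_mul hκ.le, ← Nat.cast_succ, Real.rpow_natCast, Real.rpow_natCast,
          mul_pow, pow_succ r]
        congr 1
        field_simp
    _ ≤ ENNReal.ofReal (r * β) * ENNReal.ofReal (max 1 (C * 2 ^ (n + 1) / β) * r ^ (n : ℝ)) := by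
        gcongr
        exact le_max_right _ _

theorem regular_sigma (n : ℕ) : Regular (S n) (sigma n) n :=
  ⟨S_subset_clB, measurableSet_S, exists_le_sigma_nball n, exists_sigma_nball_le n⟩

end Surface

section Packing

/-- The points of `t` are at mutual distance at least `δ`. -/
def Separated (δ : ℝ) (t : Finset (Cn n)) : Prop :=
  (t : Set (Cn n)).Pairwise fun y z => δ ≤ nd y z

/-- Every finite `δ`-separated subset of `A` has at most `B` points; unlike `packing`, this is
meant for arbitrary sets `A` and real bounds `B`. -/
def SeparatedCardLE (A : Set (Cn n)) (δ B : ℝ) : Prop :=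
  ∀ t : Finset (Cn n), (t : Set (Cn n)) ⊆ A → Separated δ t → (t.card : ℝ) ≤ B

theorem Separated.subset {δ : ℝ} {s t : Finset (Cn n)} (h : Separated δ t) (hst : s ⊆ t) :
    Separated δ s := Set.Pairwise.mono (Finset.coe_subset.mpr hst) h

theorem SeparatedCardLE.mono {A A' : Set (Cn n)} {δ δ' B B' : ℝ} (h : SeparatedCardLE A δ B)
    (hA : A' ⊆ A) (hδ : δ ≤ δ') (hB : B ≤ B') : SeparatedCardLE A' δ' B' := fun t ht hs =>
  (h t (ht.trans hA) fun _ hy _ hz hyz => hδ.trans (hs hy hz hyz)).trans hB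

theorem exists_maximal_of_card_le {α : Type*} {P : Finset α → Prop} {B : ℝ} (h₀ : P ∅)
    (hB : ∀ t, P t → (t.card : ℝ) ≤ B) : ∃ F, Maximal P F := by
  have hbdd : BddAbove {k | ∃ t, P t ∧ t.card = k} :=
    ⟨⌊B⌋₊, fun _ ⟨t, ht, hk⟩ => hk ▸ Nat.le_floor (hB t ht)⟩
  have hne : {k | ∃ t, P t ∧ t.card = k}.Nonempty := ⟨0, ∅, h₀, Finset.card_empty⟩
  obtain ⟨F, hF, hcard⟩ := Nat.sSup_mem hne hbdd
  exact ⟨F, hF, fun t ht hFt =>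
    (Finset.eq_of_subset_of_card_le hFt (hcard ▸ le_csSup hbdd ⟨t, ht, rfl⟩)).ge⟩

theorem SeparatedCardLE.exists_net {A : Set (Cn n)} (hA : A ⊆ S n) {δ B : ℝ} (hδ : 0 < δ)
    (h : SeparatedCardLE A δ B) : ∃ F : Finset (Cn n), (F : Set (Cn n)) ⊆ A ∧ Separated δ F ∧
      ∀ a ∈ A, ∃ f ∈ F, nd a f < δ := by
  classical
  obtain ⟨F, ⟨hFA, hFs⟩, hmax⟩ := exists_maximal_of_card_le
    (P := fun t : Finset (Cn n) => (t : Set (Cn n)) ⊆ A ∧ Separated δ t)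
    ⟨by simp, by simp [Separated]⟩ fun t ht => h t ht.1 ht.2
  refine ⟨F, hFA, hFs, fun a ha => ?_⟩
  by_contra! hfar
  have hsep : Separated δ (insert a F) := by
    rw [Separated, Finset.coe_insert, Set.pairwise_insert]
    exact ⟨hFs, fun b hb _ => ⟨hfar b hb, nd_comm a b ▸ hfar b hb⟩⟩
  have haF : a ∈ F := hmax
    ⟨by simpa [Set.insert_subset_iff] using ⟨ha, hFA⟩, hsep⟩ (Finset.subset_insert a F)
    (Finset.mem_insert_self a F)
  exact absurd (hfar a haF) (by rw [nd_self (hA ha)]; exact hδ.not_ge)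

theorem separatedCardLE_of_cover {A : Set (Cn n)} {F : Finset (Cn n)} {δ r B : ℝ}
    (hcover : ∀ z ∈ A, ∃ f ∈ F, nd z f < r)
    (hB : ∀ f ∈ F, SeparatedCardLE (nball A f r) δ B) :
    SeparatedCardLE A δ (F.card * B) := by
  classical
  intro t ht hs
  have hdouble := Finset.card_nsmul_le_card_nsmul (R := ℝ) (s := t) (t := F)
    (fun z f => nd z f < r) (m := 1) (n := B)
    (fun z hz => by
      obtain ⟨f, hf, hzf⟩ := hcover z (ht hz)
      exact_mod_cast Finset.card_pos.mpr ⟨f, Finset.mem_filter.mpr ⟨hf, hzf⟩⟩)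
    (fun f hf => hB f hf _
      (fun z hz => have hz' := Finset.mem_filter.mp hz; ⟨ht hz'.1, hz'.2⟩)
      (hs.subset (Finset.filter_subset _ _)))
  simpa only [nsmul_eq_mul, mul_one] using hdouble

theorem toENNReal_le_ofReal_iff {a : ℕ∞} {B : ℝ} (hB : 0 ≤ B) :
    (a : ℝ≥0∞) ≤ ENNReal.ofReal B ↔ a ≤ (⌊B⌋₊ : ℕ∞) := by
  induction a with
  | top => simp
  | coe k =>
    rw [ENat.toENNReal_coe, ← ENNReal.ofReal_natCast, ENNReal.ofReal_le_ofReal_iff hB,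
      ← Nat.le_floor_iff hB, Nat.cast_le]

theorem packing_le_ofReal_iff {x : Cn n} {δ k B : ℝ} (hB : 0 ≤ B) :
    (packing E x δ k : ℝ≥0∞) ≤ ENNReal.ofReal B ↔ SeparatedCardLE (nball E x (k * δ)) δ B := by
  rw [toENNReal_le_ofReal_iff hB]
  simp only [packing, iSup_le_iff, SeparatedCardLE, Separated, Nat.cast_le, Nat.le_floor_iff hB]

theorem inUpsilon_iff {γ : ℝ} :
    InUpsilon E γ ↔ ∃ C : ℝ, 0 < C ∧ ∀ x ∈ E, ∀ δ R : ℝ, 0 < δ → δ ≤ R → R ≤ 1 →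
      SeparatedCardLE (nball E x R) δ (C * (R / δ) ^ γ) := by
  refine exists_congr fun C => and_congr_right fun hC => forall₂_congr fun x _ => ⟨?_, ?_⟩
  · intro h δ R hδ hR hR1
    have hR0 : 0 < R := hδ.trans_le hR
    have hmul : R / δ * δ = R := div_mul_cancel₀ _ hδ.ne'
    rw [← hmul] at hR hR1
    have hpack := h δ (R / δ) hδ hR hR1
    rwa [packing_le_ofReal_iff (by positivity), hmul] at hpack
  · intro h δ k hδ hk hk1
    have hk0 : 0 < k := pos_of_mul_pos_left (hδ.trans_le hk) hδ.le
    rw [packing_le_ofReal_iff (by positivity)]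
    simpa only [mul_div_cancel_right₀ _ hδ.ne'] using h δ (k * δ) hδ hk hk1

theorem InUpsilon.mono {γ γ' : ℝ} (h : InUpsilon E γ) (hγ : γ ≤ γ') : InUpsilon E γ' := by
  obtain ⟨C, hC, h⟩ := inUpsilon_iff.mp h
  refine inUpsilon_iff.mpr ⟨C, hC, fun x hx δ R hδ hR hR1 =>
    (h x hx δ R hδ hR hR1).mono subset_rfl le_rfl ?_⟩
  gcongr
  exact (one_le_div hδ).mpr hR

theorem upperDim_lt_iff {s : ℝ} : upperDim E < (s : EReal) ↔ ∃ γ : ℝ, γ < s ∧ InUpsilon E γ := by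
  simp only [upperDim, iInf_lt_iff, EReal.coe_lt_coe_iff, exists_prop, and_comm]

theorem exists_nonneg_inUpsilon_of_upperDim_lt {s : ℝ} (hs : 0 < s) (h : upperDim E < (s : EReal)) :
    ∃ γ : ℝ, 0 ≤ γ ∧ γ < s ∧ InUpsilon E γ := by
  obtain ⟨γ, hγ, hU⟩ := upperDim_lt_iff.mp h
  exact ⟨max γ 0, le_max_right _ _, max_lt hγ hs, hU.mono (le_max_left _ _)⟩

theorem exists_finset_nd_lt (hES : E ⊆ S n) {r : ℝ} (hr : 0 < r) :
    ∃ F : Finset (Cn n), (F : Set (Cn n)) ⊆ E ∧ ∀ z ∈ E, ∃ e ∈ F, nd z e < r := by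
  have hE : TotallyBounded E := (isCompact_sphere (0 : Cn n) 1).totallyBounded.subset hES
  obtain ⟨F, hFE, hF, hcover⟩ := Metric.finite_approx_of_totallyBounded hE r hr
  lift F to Finset (Cn n) using hF
  refine ⟨F, hFE, fun z hz => ?_⟩
  obtain ⟨e, he, hze⟩ := Set.mem_iUnion₂.mp (hcover hz)
  exact ⟨e, he, (nd_le_norm_sub (hES (hFE he)) z).trans_lt (mem_ball_iff_norm.mp hze)⟩

theorem InUpsilon.exists_separatedCardLE (hES : E ⊆ S n) {γ : ℝ} (hγ : 0 ≤ γ) (h : InUpsilon E γ) :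
    ∃ C : ℝ, 0 < C ∧ ∀ x ∈ E, ∀ δ R : ℝ, 0 < δ → δ ≤ R →
      SeparatedCardLE (nball E x R) δ (C * (R / δ) ^ γ) := by
  obtain ⟨C, hC, hloc⟩ := inUpsilon_iff.mp h
  obtain ⟨F, hFE, hF⟩ := exists_finset_nd_lt hES one_pos
  have hglob : ∀ δ : ℝ, 0 < δ → δ ≤ 1 → SeparatedCardLE E δ (F.card * (C * (1 / δ) ^ γ)) :=
    fun δ hδ hδ1 => separatedCardLE_of_cover hF fun e he => hloc e (hFE he) δ 1 hδ hδ1 le_rfl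
  refine ⟨(F.card + 1) * C, by positivity, fun x hx δ R hδ hR => ?_⟩
  have hR0 : 0 < R := hδ.trans_le hR
  rcases le_or_gt R 1 with hR1 | hR1
  · refine (hloc x hx δ R hδ hR hR1).mono subset_rfl le_rfl ?_
    gcongr
    exact le_mul_of_one_le_left hC.le (le_add_of_nonneg_left F.card.cast_nonneg)
  have hmin : 0 < min δ 1 := lt_min hδ one_pos
  refine (hglob _ hmin (min_le_right _ _)).mono (fun z hz => hz.1) (min_le_left _ _) ?_
  have hle : 1 / min δ 1 ≤ R / δ := by
    rcases le_total δ 1 with hδ1 | hδ1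
    · rw [min_eq_left hδ1]; gcongr
    · rw [min_eq_right hδ1, one_div_one]; exact (one_le_div hδ).mpr hR
  rw [← mul_assoc]
  gcongr
  exact le_add_of_nonneg_right zero_le_one

theorem InUpsilon.exists_separatedCardLE_of_mem_S (hES : E ⊆ S n) {γ : ℝ} (hγ : 0 ≤ γ)
    (h : InUpsilon E γ) : ∃ C : ℝ, 0 < C ∧ ∀ x ∈ S n, ∀ δ R : ℝ, 0 < δ → δ ≤ R →
      SeparatedCardLE (nball E x R) δ (C * (R / δ) ^ γ) := by
  obtain ⟨C, hC, h⟩ := h.exists_separatedCardLE hES hγ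
  refine ⟨C * 6 ^ γ, by positivity, fun x hx δ R hδ hR => ?_⟩
  have hR0 : 0 < R := hδ.trans_le hR
  rcases (nball E x R).eq_empty_or_nonempty with hempty | ⟨e, he, hex⟩
  · intro t ht _
    rw [hempty, Set.subset_empty_iff, Finset.coe_eq_empty] at ht
    rw [ht, Finset.card_empty, Nat.cast_zero]
    positivity
  refine (h e he δ (6 * R) hδ (by linarith)).mono ?_ le_rfl (le_of_eq ?_)
  · refine (nball_subset_nball (hES.trans S_subset_clB) (S_subset_clB (hES he))
      (S_subset_clB hx) R).trans (nball_mono subset_rfl e ?_)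
    rw [nd_comm] at hex
    linarith
  · rw [mul_div_assoc, Real.mul_rpow (by norm_num) (by positivity), mul_assoc]

end Packing

section Neighbourhoods

theorem nball_inter_nbhd_subset {F : Finset (Cn n)} (hES : E ⊆ S n) (hX : X ⊆ clB n)
    (hFE : (F : Set (Cn n)) ⊆ E) {x : Cn n} (hx : x ∈ S n) {R ε δ : ℝ}
    (hF : ∀ y ∈ nball E x (3 * (ε + R)), ∃ f ∈ F, nd y f < δ) :
    nball X x R ∩ nbhd X E ε ⊆ ⋃ f ∈ F, nball X f (3 * (ε + δ)) := by
  rintro z ⟨⟨hzX, hzR⟩, -, hzε⟩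
  obtain ⟨y, hy, hzy⟩ := ndSet_lt_ofReal_iff.mp hzε
  have hyx : nd y x < 3 * (ε + R) := by
    have := nd_triangle (S_subset_clB (hES hy)) (hX hzX) (S_subset_clB hx)
    rw [nd_comm y z] at this
    linarith
  obtain ⟨f, hf, hyf⟩ := hF y ⟨hy, hyx⟩
  have := nd_triangle (hX hzX) (S_subset_clB (hES hy)) (S_subset_clB (hES (hFE hf)))
  exact Set.mem_iUnion₂.mpr ⟨f, hf, hzX, by linarith⟩

theorem InUpsilon.exists_measure_nbhd_le (hES : E ⊆ S n) {m γ : ℝ} (hμ : Regular X μ m) (hγ : 0 ≤ γ)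
    (h : InUpsilon E γ) :
    ∃ C : ℝ, 0 < C ∧ ∀ x ∈ S n, ∀ R ε : ℝ, 0 < ε → ε < R →
      μ (nball X x R ∩ nbhd X E ε) ≤ ENNReal.ofReal (C * R ^ γ * ε ^ (m - γ)) := by
  obtain ⟨C, hC, hcard⟩ := h.exists_separatedCardLE_of_mem_S hES hγ
  obtain ⟨D, hD, hball⟩ := hμ.exists_measure_nball_le
  refine ⟨C * 6 ^ γ * (D * 6 ^ m), by positivity, fun x hx R ε hε hεR => ?_⟩
  have hR : 0 < R := hε.trans hεR
  have hsep : SeparatedCardLE (nball E x (3 * (ε + R))) ε (C * (6 * R / ε) ^ γ) :=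
    (hcard x hx ε (6 * R) hε (by linarith)).mono (nball_mono subset_rfl x (by linarith))
      le_rfl le_rfl
  obtain ⟨F, hFA, hFsep, hF⟩ := hsep.exists_net (fun z hz => hES hz.1) hε
  have hFE : (F : Set (Cn n)) ⊆ E := fun f hf => (hFA hf).1
  have hreal : F.card * (D * (6 * ε) ^ m) ≤ C * 6 ^ γ * (D * 6 ^ m) * R ^ γ * ε ^ (m - γ) :=
    calc F.card * (D * (6 * ε) ^ m) ≤ C * (6 * R / ε) ^ γ * (D * (6 * ε) ^ m) := by
          gcongr
          exact hsep F hFA hFsep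
      _ = _ := by
          rw [Real.div_rpow (by positivity) hε.le, Real.mul_rpow (by norm_num) hR.le,
            Real.mul_rpow (by norm_num) hε.le, Real.rpow_sub hε]
          field_simp
  calc μ (nball X x R ∩ nbhd X E ε)
      ≤ μ (⋃ f ∈ F, nball X f (3 * (ε + ε))) :=
        measure_mono (nball_inter_nbhd_subset hES hμ.subset_clB hFE hx hF)
    _ ≤ ∑ f ∈ F, μ (nball X f (3 * (ε + ε))) := measure_biUnion_finset_le _ _
    _ ≤ F.card • ENNReal.ofReal (D * (6 * ε) ^ m) :=
        Finset.sum_le_card_nsmul _ _ _ fun f hf => by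
          rw [show 3 * (ε + ε) = 6 * ε by ring]
          exact hball f (hES (hFE hf)) _ (by positivity)
    _ ≤ _ := by
        rw [← ENNReal.ofReal_nsmul, nsmul_eq_mul]
        exact ENNReal.ofReal_le_ofReal hreal

theorem Separated.card_mul_le_measure (hX : X ⊆ clB n) {A : Set (Cn n)} {t : Finset (Cn n)} {δ : ℝ}
    {b : ℝ≥0∞} (ht : (t : Set (Cn n)) ⊆ S n) (hs : Separated δ t) {H : Cn n → Set (Cn n)}
    (hH : ∀ y, MeasurableSet (H y)) (hHX : ∀ y ∈ t, H y ⊆ nball X y (δ / 6))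
    (hHA : ∀ y ∈ t, H y ⊆ A) (hb : ∀ y ∈ t, b ≤ μ (H y)) : t.card * b ≤ μ A := by
  have hdisj : (t : Set (Cn n)).PairwiseDisjoint H := by
    intro y hy w hw hyw
    refine Set.disjoint_left.mpr fun z hz hz' => ?_
    have hzy := hHX y hy hz
    have hyzw := nd_triangle (S_subset_clB (ht hy)) (hX hzy.1) (S_subset_clB (ht hw))
    rw [nd_comm y z] at hyzw
    linarith [hs hy hw hyw, hzy.2, (hHX w hw hz').2]
  calc t.card * b = t.card • b := (nsmul_eq_mul _ _).symm
    _ ≤ ∑ y ∈ t, μ (H y) := Finset.card_nsmul_le_sum _ _ _ hb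
    _ = μ (⋃ y ∈ t, H y) := (measure_biUnion_finset hdisj fun y _ => hH y).symm
    _ ≤ μ A := measure_mono (Set.iUnion₂_subset hHA)

theorem separatedCardLE_of_measure_nbhd_le (hES : E ⊆ S n) {m : ℝ} (hμ : Regular X μ m) :
    ∃ c : ℝ, 0 < c ∧
    ∀ x ∈ E, ∀ δ R B : ℝ, 0 < δ → δ ≤ R → R ≤ 1 → 0 ≤ B →
      μ (nball X x (6 * R) ∩ nbhd X E δ) ≤ ENNReal.ofReal B →
      SeparatedCardLE (nball E x R) δ (B / (c * δ ^ m)) := by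
  obtain ⟨c, hc, hlow⟩ := hμ.exists_le_measure_nball
  refine ⟨c / 6 ^ m, by positivity, fun x hx δ R B hδ hR hR1 hB h t ht hs => ?_⟩
  have htE : (t : Set (Cn n)) ⊆ E := fun y hy => (ht hy).1
  have hsub : ∀ y ∈ t, nball X y (δ / 6) ⊆ nball X x (6 * R) ∩ nbhd X E δ := by
    intro y hy
    refine Set.subset_inter ((nball_subset_nball hμ.subset_clB (S_subset_clB (hES hx))
      (S_subset_clB (hES (htE hy))) _).trans (nball_mono subset_rfl x ?_)) fun z hz =>
        ⟨hz.1, ndSet_lt_ofReal_iff.mpr ⟨y, htE hy, by linarith [hz.2]⟩⟩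
    linarith [(ht hy).2]
  have hcard := (hs.card_mul_le_measure hμ.subset_clB (htE.trans hES)
    (fun y => measurableSet_nball hμ.measurableSet y (δ / 6)) (fun y _ => subset_rfl) hsub
    fun y hy => hlow y (hES (htE hy)) _ (by positivity) (by linarith)).trans h
  rw [← ENNReal.ofReal_natCast, ← ENNReal.ofReal_mul (by positivity),
    ENNReal.ofReal_le_ofReal_iff hB, Real.div_rpow hδ.le (by norm_num)] at hcard
  rw [le_div_iff₀ (by positivity)]
  exact (le_of_eq (by ring)).trans hcard

theorem inUpsilon_of_measure_nbhd_le (hES : E ⊆ S n) {m s C : ℝ} (hμ : Regular X μ m) (hC : 0 < C)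
    (h : ∀ x ∈ E, ∀ R ε : ℝ, 0 < ε → ε < R →
      μ (nball X x R ∩ nbhd X E ε) ≤ ENNReal.ofReal (C * R ^ s * ε ^ (m - s))) : InUpsilon E s := by
  obtain ⟨c, hc, hcard⟩ := separatedCardLE_of_measure_nbhd_le hES hμ
  refine inUpsilon_iff.mpr ⟨C * 6 ^ s / c, by positivity, fun x hx δ R hδ hR hR1 => ?_⟩
  have hR0 : 0 < R := hδ.trans_le hR
  refine (hcard x hx δ R _ hδ hR hR1 (by positivity)
    (h x hx (6 * R) δ hδ (by linarith))).mono subset_rfl le_rfl (le_of_eq ?_)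
  rw [Real.mul_rpow (by norm_num) hR0.le, Real.rpow_sub hδ, Real.div_rpow hR0.le hδ.le]
  field_simp

end Neighbourhoods

section PowerIntegrals

theorem exists_dyadic {d r : ℝ} (hd : 0 < d) (hdr : d < r) :
    ∃ j : ℕ, r / 2 ^ (j + 1) ≤ d ∧ d < r / 2 ^ j := by
  obtain ⟨j, hlow, hup⟩ := exists_mem_Ioc_zpow (div_pos (hd.trans hdr) hd) one_lt_two
  have hj : 0 < j + 1 :=
    (one_lt_zpow_iff_right₀ one_lt_two).mp (((one_lt_div hd).mpr hdr).trans_le hup)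
  lift j to ℕ using by omega
  rw [lt_div_comm₀ (by positivity) hd] at hlow
  rw [div_le_comm₀ hd (by positivity)] at hup
  exact ⟨j, mod_cast hup, mod_cast hlow⟩

theorem rpow_neg_le_ofReal {d : ℝ≥0∞} {r a : ℝ} (hr : 0 < r) (ha : 0 ≤ a)
    (h : ENNReal.ofReal r ≤ d) : d ^ (-a) ≤ ENNReal.ofReal (r ^ (-a)) := by
  rw [← ENNReal.ofReal_rpow_of_pos hr, ENNReal.rpow_neg, ENNReal.rpow_neg, ENNReal.inv_le_inv]
  exact ENNReal.rpow_le_rpow h ha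

theorem rpow_neg_le_tsum (d : ℝ≥0∞) {r a : ℝ} (hr : 0 < r) (ha : 0 ≤ a) :
    d ^ (-a) ≤ ENNReal.ofReal (r ^ (-a)) +
      ∑' j : ℕ, (Set.Iio (ENNReal.ofReal (r / 2 ^ j))).indicator
        (fun _ => ENNReal.ofReal ((r / 2 ^ (j + 1)) ^ (-a))) d := by
  rcases le_or_gt (ENNReal.ofReal r) d with hrd | hdr
  · exact (rpow_neg_le_ofReal hr ha hrd).trans le_self_add
  refine le_add_left ?_
  lift d to NNReal using (hdr.trans ENNReal.ofReal_lt_top).ne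
  rw [← ENNReal.ofReal_coe_nnreal] at hdr ⊢
  rcases d.coe_nonneg.eq_or_lt' with hd | hd
  · refine le_of_le_of_eq le_top (Eq.symm ?_)
    refine top_unique <| (ENNReal.tsum_const_eq_top_of_ne_zero
      (ENNReal.ofReal_pos.mpr (Real.rpow_pos_of_pos hr (-a))).ne').ge.trans
      (ENNReal.tsum_le_tsum fun j => ?_)
    have hmem : ENNReal.ofReal 0 < ENNReal.ofReal (r / 2 ^ j) :=
      (ENNReal.ofReal_lt_ofReal_iff (by positivity)).mpr (by positivity)
    rw [hd, Set.indicator_of_mem (Set.mem_Iio.mpr hmem)]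
    exact ENNReal.ofReal_le_ofReal (Real.rpow_le_rpow_of_nonpos (by positivity)
      (div_le_self hr.le (one_le_pow₀ one_le_two)) (neg_nonpos.mpr ha))
  · obtain ⟨j, hlow, hup⟩ := exists_dyadic hd ((ENNReal.ofReal_lt_ofReal_iff hr).mp hdr)
    refine le_trans ?_ (ENNReal.le_tsum j)
    have hmem := (ENNReal.ofReal_lt_ofReal_iff (hd.trans hup)).mpr hup
    rw [Set.indicator_of_mem (Set.mem_Iio.mpr hmem)]
    exact rpow_neg_le_ofReal (by positivity) ha (ENNReal.ofReal_le_ofReal hlow)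

theorem rpow_neg_mul_rpow_div_two_pow {r : ℝ} (hr : 0 < r) (a b : ℝ) (j : ℕ) :
    (r / 2 ^ (j + 1)) ^ (-a) * (r / 2 ^ j) ^ b = 2 ^ a * r ^ (b - a) * (2 ^ (a - b)) ^ j := by
  have hj : 0 < r / 2 ^ j := by positivity
  calc (r / 2 ^ (j + 1)) ^ (-a) * (r / 2 ^ j) ^ b
      = 2 ^ a * ((r / 2 ^ j) ^ b / (r / 2 ^ j) ^ a) := by
        rw [pow_succ, ← div_div, Real.div_rpow hj.le zero_le_two, Real.rpow_neg hj.le,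
          Real.rpow_neg zero_le_two]
        field_simp
    _ = 2 ^ a * r ^ (b - a) * (2 ^ (a - b)) ^ j := by
        rw [← Real.rpow_sub hj, Real.div_rpow hr.le (by positivity),
          ← Real.rpow_pow_comm zero_le_two, ← neg_sub b a, Real.rpow_neg zero_le_two, inv_pow]
        field_simp

theorem lintegral_rpow_neg_le {α : Type*} [MeasurableSpace α] {μ : Measure α} {A : Set α}
    {f : α → ℝ≥0∞} (hf : Measurable f) {r a b K : ℝ} (hr : 0 < r) (ha : 0 ≤ a) (hab : a < b)
    (hK : 0 ≤ K) (h : ∀ ε : ℝ, 0 < ε → ε ≤ r →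
      μ (A ∩ {x | f x < ENNReal.ofReal ε}) ≤ ENNReal.ofReal (K * ε ^ b)) :
    ∫⁻ x in A, f x ^ (-a) ∂μ ≤ ENNReal.ofReal (r ^ (-a)) * μ A +
      ENNReal.ofReal (K * 2 ^ a * (1 - 2 ^ (a - b))⁻¹ * r ^ (b - a)) := by
  have hq : (2 : ℝ) ^ (a - b) < 1 := Real.rpow_lt_one_of_one_lt_of_neg one_lt_two (by linarith)
  have hmeas : ∀ j : ℕ, MeasurableSet {x | f x < ENNReal.ofReal (r / 2 ^ j)} :=
    fun j => hf measurableSet_Iio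
  have hterm : ∀ j : ℕ, ∫⁻ x in A, {x | f x < ENNReal.ofReal (r / 2 ^ j)}.indicator
      (fun _ => ENNReal.ofReal ((r / 2 ^ (j + 1)) ^ (-a))) x ∂μ ≤
      ENNReal.ofReal (K * 2 ^ a * r ^ (b - a) * (2 ^ (a - b)) ^ j) := by
    intro j
    have hj : 0 < r / 2 ^ j := by positivity
    rw [lintegral_indicator_const (hmeas j), Measure.restrict_apply (hmeas j), Set.inter_comm]
    refine (mul_le_mul_right (h _ hj (div_le_self hr.le (one_le_pow₀ one_le_two))) _).trans ?_
    rw [← ENNReal.ofReal_mul (by positivity)]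
    refine ENNReal.ofReal_le_ofReal (le_of_eq ?_)
    rw [mul_left_comm, rpow_neg_mul_rpow_div_two_pow hr]
    ring
  calc ∫⁻ x in A, f x ^ (-a) ∂μ
      ≤ ∫⁻ x in A, (ENNReal.ofReal (r ^ (-a)) +
          ∑' j : ℕ, {x | f x < ENNReal.ofReal (r / 2 ^ j)}.indicator
            (fun _ => ENNReal.ofReal ((r / 2 ^ (j + 1)) ^ (-a))) x) ∂μ :=
        lintegral_mono fun x => rpow_neg_le_tsum (f x) hr ha
    _ = ENNReal.ofReal (r ^ (-a)) * μ A +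
          ∑' j : ℕ, ∫⁻ x in A, {x | f x < ENNReal.ofReal (r / 2 ^ j)}.indicator
            (fun _ => ENNReal.ofReal ((r / 2 ^ (j + 1)) ^ (-a))) x ∂μ := by
        rw [lintegral_add_left measurable_const, setLIntegral_const,
          lintegral_tsum fun j => (measurable_const.indicator (hmeas j)).aemeasurable]
    _ ≤ _ := by
        gcongr
        refine (ENNReal.tsum_le_tsum hterm).trans_eq ?_
        rw [← ENNReal.ofReal_tsum_of_nonneg (fun j => by positivity)
          ((summable_geometric_of_lt_one (by positivity) hq).mul_left _), tsum_mul_left,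
          tsum_geometric_of_lt_one (by positivity) hq, mul_right_comm]

theorem exists_lintegral_ndSet_rpow_neg_le {m s a C : ℝ} (hμ : Regular X μ m) (hC : 0 < C)
    (h : ∀ x ∈ S n, ∀ R ε : ℝ, 0 < ε → ε < R →
      μ (nball X x R ∩ nbhd X E ε) ≤ ENNReal.ofReal (C * R ^ s * ε ^ (m - s))) (ha : 0 ≤ a)
    (has : a < m - s) :
    ∃ C' : ℝ, 0 < C' ∧ ∀ x ∈ S n, ∀ R : ℝ, 0 < R →
      ∫⁻ z in nball X x R, ndSet z E ^ (-a) ∂μ ≤ ENNReal.ofReal (C' * R ^ (m - a)) := by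
  obtain ⟨D, hD, hball⟩ := hμ.exists_measure_nball_le
  set q : ℝ := 1 - 2 ^ (a - (m - s)) with hq
  have hq0 : 0 < q := sub_pos.mpr (Real.rpow_lt_one_of_one_lt_of_neg one_lt_two (by linarith))
  refine ⟨2 ^ a * D + C * 2 ^ a * q⁻¹ * 2⁻¹ ^ (m - s - a), by positivity, fun x hx R hR => ?_⟩
  have hnbhd : ∀ ε : ℝ, 0 < ε → ε ≤ R / 2 →
      μ (nball X x R ∩ {z | ndSet z E < ENNReal.ofReal ε}) ≤
        ENNReal.ofReal (C * R ^ s * ε ^ (m - s)) := fun ε hε hεR =>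
    (measure_mono (t := nball X x R ∩ nbhd X E ε) fun z hz => ⟨hz.1, hz.1.1, hz.2⟩).trans
      (h x hx R ε hε (by linarith))
  refine (lintegral_rpow_neg_le (measurable_ndSet E) (half_pos hR) ha has (by positivity)
    hnbhd).trans ?_
  refine (add_le_add_left (mul_le_mul_right (hball x hx R hR) _) _).trans_eq ?_
  rw [← hq, ← ENNReal.ofReal_mul (by positivity),
    ← ENNReal.ofReal_add (by positivity) (by positivity)]
  congr 1
  rw [div_eq_mul_inv R 2, Real.mul_rpow hR.le (by norm_num), Real.mul_rpow hR.le (by norm_num),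
    Real.rpow_neg hR.le, Real.inv_rpow zero_le_two (-a), Real.rpow_neg zero_le_two,
    Real.rpow_sub hR m a, Real.rpow_sub hR (m - s), Real.rpow_sub hR m s]
  field_simp

theorem measure_inter_lt_le_lintegral_rpow_neg {α : Type*} [MeasurableSpace α] {μ : Measure α}
    {A : Set α} {f : α → ℝ≥0∞} (hf : Measurable f) {ε a : ℝ} (hε : 0 < ε) (ha : 0 ≤ a) :
    μ (A ∩ {x | f x < ENNReal.ofReal ε}) ≤
      ENNReal.ofReal (ε ^ a) * ∫⁻ x in A, f x ^ (-a) ∂μ := by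
  have hpos : 0 < ε ^ (-a) := Real.rpow_pos_of_pos hε _
  have hsub : {x | f x < ENNReal.ofReal ε} ⊆ {x | ENNReal.ofReal (ε ^ (-a)) ≤ f x ^ (-a)} := by
    intro x hx
    rw [Set.mem_ofPred_eq, ← ENNReal.ofReal_rpow_of_pos hε, ENNReal.rpow_neg, ENNReal.rpow_neg,
      ENNReal.inv_le_inv]
    exact ENNReal.rpow_le_rpow (le_of_lt hx) ha
  calc μ (A ∩ {x | f x < ENNReal.ofReal ε})
      ≤ μ.restrict A {x | ENNReal.ofReal (ε ^ (-a)) ≤ f x ^ (-a)} := by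
        rw [Set.inter_comm]
        exact (Measure.le_restrict_apply _ _).trans (measure_mono hsub)
    _ ≤ (∫⁻ x in A, f x ^ (-a) ∂μ) / ENNReal.ofReal (ε ^ (-a)) :=
        meas_ge_le_lintegral_div (hf.pow_const _).aemeasurable
          (ENNReal.ofReal_pos.mpr hpos).ne' ENNReal.ofReal_ne_top
    _ = ENNReal.ofReal (ε ^ a) * ∫⁻ x in A, f x ^ (-a) ∂μ := by
        rw [div_eq_mul_inv, ← ENNReal.ofReal_inv_of_pos hpos, Real.rpow_neg hε.le, inv_inv,
          mul_comm]

theorem VolumeIntegralBound.volumeBound (hES : E ⊆ S n) (h : VolumeIntegralBound E) :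
    VolumeBound E := by
  obtain ⟨a₀, ha₀, h⟩ := h
  obtain ⟨a, ha1, haa₀⟩ := exists_between ha₀
  have ha : 0 ≤ a := by linarith
  obtain ⟨C, hC, h⟩ := h a ha haa₀
  refine ⟨n + 1 - a, C, by linarith, hC, fun x hx R ε hε hεR => ?_⟩
  calc V n (nball (clB n) x R ∩ nbhd (clB n) E ε)
      ≤ V n (nball (clB n) x R ∩ {z | ndSet z E < ENNReal.ofReal ε}) :=
        measure_mono (Set.inter_subset_inter_right _ fun z hz => hz.2)
    _ ≤ ENNReal.ofReal (ε ^ a) * ENNReal.ofReal (C * R ^ ((n : ℝ) + 1 - a)) :=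
        (measure_inter_lt_le_lintegral_rpow_neg (measurable_ndSet E) hε ha).trans
          (mul_le_mul_right (h x (hES hx) R (hε.trans hεR)) _)
    _ = _ := by
        rw [← ENNReal.ofReal_mul (by positivity), sub_sub_cancel, mul_comm]

end PowerIntegrals

section PackingIntegral

theorem lintegral_Ioo_rpow {R b : ℝ} (hR : 0 ≤ R) (hb : 0 < b) :
    ∫⁻ t in Set.Ioo 0 R, ENNReal.ofReal (t ^ b / t) = ENNReal.ofReal (R ^ b / b) := by
  have hint : IntegrableOn (fun t : ℝ => t ^ (b - 1)) (Set.Ioo 0 R) :=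
    (intervalIntegrable_iff_integrableOn_Ioo_of_le hR).mp
      (intervalIntegral.intervalIntegrable_rpow' (by linarith))
  have hpos : 0 ≤ᵐ[volume.restrict (Set.Ioo 0 R)] fun t : ℝ => t ^ (b - 1) :=
    ae_restrict_of_forall_mem measurableSet_Ioo fun t ht => Real.rpow_nonneg ht.1.le _
  calc ∫⁻ t in Set.Ioo 0 R, ENNReal.ofReal (t ^ b / t)
      = ∫⁻ t in Set.Ioo 0 R, ENNReal.ofReal (t ^ (b - 1)) :=
        setLIntegral_congr_fun measurableSet_Ioo fun t ht => by rw [Real.rpow_sub_one ht.1.ne']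
    _ = ENNReal.ofReal (∫ t in (0)..R, t ^ (b - 1)) := by
        rw [← ofReal_integral_eq_lintegral_ofReal hint hpos, ← integral_Ioc_eq_integral_Ioo,
          intervalIntegral.integral_of_le hR]
    _ = ENNReal.ofReal (R ^ b / b) := by
        rw [integral_rpow (Or.inl (by linarith)), sub_add_cancel, Real.zero_rpow hb.ne', sub_zero]

theorem card_le_packing {x : Cn n} {δ k : ℝ} {t : Finset (Cn n)}
    (ht : (t : Set (Cn n)) ⊆ nball E x (k * δ)) (hs : Separated δ t) :
    (t.card : ℝ≥0∞) ≤ packing E x δ k := by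
  have hcard : (t.card : ℕ∞) ≤ packing E x δ k :=
    le_iSup_of_le t <| le_iSup₂_of_le ht hs le_rfl
  exact_mod_cast ENat.toENNReal_le.mpr hcard

theorem PackingIntegralBound.exists_inUpsilon (h : PackingIntegralBound E) :
    ∃ γ : ℝ, γ < n ∧ InUpsilon E γ := by
  obtain ⟨a, C, ha, han, hC, h⟩ := h
  set b : ℝ := n - a with hb
  have hb0 : 0 < b := sub_pos.mpr han
  refine ⟨b, by linarith, inUpsilon_iff.mpr ⟨C * b, by positivity,
    fun x hx δ R hδ hR _ t ht hs => ?_⟩⟩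
  have hR0 : 0 < R := hδ.trans_le hR
  have hint : t.card * ENNReal.ofReal (δ ^ b / b) ≤ ENNReal.ofReal (C * R ^ b) :=
    calc t.card * ENNReal.ofReal (δ ^ b / b)
        = ∫⁻ η in Set.Ioo 0 δ, t.card * ENNReal.ofReal (η ^ b / η) := by
          rw [lintegral_const_mul _ (by fun_prop), lintegral_Ioo_rpow hδ.le hb0]
      _ ≤ ∫⁻ η in Set.Ioo 0 δ, (packing E x η (R / η) : ℝ≥0∞) * ENNReal.ofReal (η ^ b / η) :=
          setLIntegral_mono' measurableSet_Ioo fun η hη => mul_le_mul_left (card_le_packing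
            (by rwa [div_mul_cancel₀ _ hη.1.ne']) fun y hy z hz hyz =>
              hη.2.le.trans (hs hy hz hyz)) _
      _ ≤ ∫⁻ η in Set.Ioo 0 R, (packing E x η (R / η) : ℝ≥0∞) * ENNReal.ofReal (η ^ b / η) :=
          lintegral_mono_set (Set.Ioo_subset_Ioo_right hR)
      _ ≤ ENNReal.ofReal (C * R ^ b) := h x hx R hR0
  rw [← ENNReal.ofReal_natCast, ← ENNReal.ofReal_mul (by positivity),
    ENNReal.ofReal_le_ofReal_iff (by positivity), mul_div_assoc', div_le_iff₀ hb0] at hint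
  rw [Real.div_rpow hR0.le hδ.le, mul_div_assoc', le_div_iff₀ (by positivity)]
  linarith

theorem InUpsilon.packingIntegralBound (hES : E ⊆ S n) {γ : ℝ} (hγ : 0 ≤ γ) (hγn : γ < n)
    (h : InUpsilon E γ) : PackingIntegralBound E := by
  obtain ⟨C, hC, hcard⟩ := h.exists_separatedCardLE hES hγ
  set a : ℝ := (n - γ) / 2 with ha
  have ha0 : 0 < a := half_pos (sub_pos.mpr hγn)
  have hna : (n : ℝ) - a = γ + a := by rw [ha]; ring
  refine ⟨a, C / a, ha0, by linarith, by positivity, fun x hx R hR => ?_⟩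
  have hpack : ∀ δ ∈ Set.Ioo 0 R, (packing E x δ (R / δ) : ℝ≥0∞) *
      ENNReal.ofReal (δ ^ ((n : ℝ) - a) / δ) ≤
      ENNReal.ofReal (C * R ^ γ) * ENNReal.ofReal (δ ^ a / δ) := by
    rintro δ ⟨hδ, hδR⟩
    have hN : (packing E x δ (R / δ) : ℝ≥0∞) ≤ ENNReal.ofReal (C * (R / δ) ^ γ) := by
      rw [packing_le_ofReal_iff (by positivity), div_mul_cancel₀ _ hδ.ne']
      exact hcard x hx δ R hδ hδR.le
    refine (mul_le_mul_left hN _).trans_eq ?_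
    rw [← ENNReal.ofReal_mul (by positivity), ← ENNReal.ofReal_mul (by positivity), hna,
      Real.rpow_add hδ, Real.div_rpow hR.le hδ.le]
    congr 1
    field_simp
  refine (setLIntegral_mono' measurableSet_Ioo hpack).trans_eq ?_
  rw [lintegral_const_mul _ (by fun_prop), lintegral_Ioo_rpow hR.le ha0,
    ← ENNReal.ofReal_mul (by positivity), hna, Real.rpow_add hR]
  congr 1
  ring

end PackingIntegral

section LogIntegral

theorem toENNReal_add_ofReal_neg_le {f : EReal} {c : ℝ} {g : ℝ≥0∞} (h : f ≤ c + g) :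
    f.toENNReal + ENNReal.ofReal (-c) ≤ (-f).toENNReal + (ENNReal.ofReal c + g) := by
  induction g with
  | top => simp
  | coe g =>
  induction f with
  | bot => simp
  | top => exact absurd (top_le_iff.mp h) (EReal.add_ne_top (by simp) (by simp))
  | coe f =>
  have hfg : f ≤ c + g := by
    rwa [EReal.coe_nnreal_eq_coe_real, ← EReal.coe_add,
      EReal.coe_le_coe_iff] at h
  rw [← EReal.coe_neg, EReal.real_coe_toENNReal, EReal.real_coe_toENNReal,
    ← ENNReal.toReal_le_toReal (by finiteness) (by finiteness)]
  simp only [ENNReal.toReal_add, ENNReal.toReal_ofReal', ne_eq, ENNReal.ofReal_ne_top,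
    ENNReal.coe_ne_top, ENNReal.add_eq_top, or_self, not_false_eq_true, ENNReal.coe_toReal]
  linarith [max_zero_sub_eq_self f, max_zero_sub_eq_self c]

theorem eintegral_le {A : Set (Cn n)} (hμA : μ A ≠ ∞) {f : Cn n → EReal} {g : Cn n → ℝ≥0∞}
    (hg : Measurable g) {c G : ℝ} (hG : 0 ≤ G) (hgG : ∫⁻ z in A, g z ∂μ ≤ ENNReal.ofReal G)
    (hfg : ∀ z, f z ≤ c + g z) : eintegral μ A f ≤ ((μ.real A * c + G : ℝ) : EReal) := by
  have hM : 0 ≤ μ.real A := measureReal_nonneg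
  set P := ∫⁻ z in A, (f z).toENNReal ∂μ
  set Q := ∫⁻ z in A, (-f z).toENNReal ∂μ
  have hint : P + ENNReal.ofReal (-c) * μ A ≤ Q + (ENNReal.ofReal c * μ A + ENNReal.ofReal G) :=
    calc P + ENNReal.ofReal (-c) * μ A
        = ∫⁻ z in A, ((f z).toENNReal + ENNReal.ofReal (-c)) ∂μ := by
          rw [lintegral_add_right _ measurable_const, setLIntegral_const]
      _ ≤ ∫⁻ z in A, ((-f z).toENNReal + (ENNReal.ofReal c + g z)) ∂μ :=
          lintegral_mono fun z => toENNReal_add_ofReal_neg_le (hfg z)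
      _ = Q + (ENNReal.ofReal c * μ A + ∫⁻ z in A, g z ∂μ) := by
          rw [lintegral_add_right _ (hg.const_add _), lintegral_add_left measurable_const,
            setLIntegral_const]
      _ ≤ Q + (ENNReal.ofReal c * μ A + ENNReal.ofReal G) := by gcongr
  rw [← ofReal_measureReal hμA, ← ENNReal.ofReal_mul' hM, ← ENNReal.ofReal_mul' hM,
    ← EReal.coe_ennreal_le_coe_ennreal_iff, EReal.coe_ennreal_add, EReal.coe_ennreal_add,
    EReal.coe_ennreal_add, EReal.coe_ennreal_ofReal, EReal.coe_ennreal_ofReal,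
    EReal.coe_ennreal_ofReal, max_eq_left hG, ← EReal.coe_add,
    ← EReal.le_sub_iff_add_le (by simp) (by simp), sub_eq_add_neg, add_assoc, ← EReal.coe_neg,
    ← EReal.coe_add] at hint
  refine EReal.sub_le_of_le_add' (hint.trans_eq ?_)
  congr 2
  rw [neg_mul]
  linear_combination max_zero_sub_eq_self (c * μ.real A)

theorem mul_measureReal_le_eintegral {A : Set (Cn n)} (hμA : μ A ≠ ∞) (hA : MeasurableSet A)
    {f : Cn n → EReal} {c : ℝ} (hf : ∀ z ∈ A, (c : EReal) ≤ f z) :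
    ((c * μ.real A : ℝ) : EReal) ≤ eintegral μ A f := by
  have hM : 0 ≤ μ.real A := measureReal_nonneg
  have hpos : ENNReal.ofReal c * μ A ≤ ∫⁻ z in A, (f z).toENNReal ∂μ := by
    rw [← setLIntegral_const]
    refine setLIntegral_mono' hA fun z hz => ?_
    rw [← EReal.real_coe_toENNReal]
    exact EReal.toENNReal_le_toENNReal (hf z hz)
  have hneg : ∫⁻ z in A, (-f z).toENNReal ∂μ ≤ ENNReal.ofReal (-c) * μ A := by
    rw [← setLIntegral_const]
    refine setLIntegral_mono' hA fun z hz => ?_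
    rw [← EReal.real_coe_toENNReal, EReal.coe_neg]
    exact EReal.toENNReal_le_toENNReal (EReal.neg_le_neg_iff.mpr (hf z hz))
  refine le_of_eq_of_le ?_ (EReal.sub_le_sub (EReal.coe_ennreal_le_coe_ennreal_iff.mpr hpos)
    (EReal.coe_ennreal_le_coe_ennreal_iff.mpr hneg))
  rw [← ofReal_measureReal hμA, ← ENNReal.ofReal_mul' hM, ← ENNReal.ofReal_mul' hM,
    EReal.coe_ennreal_ofReal, EReal.coe_ennreal_ofReal, ← EReal.coe_sub, neg_mul,
    max_zero_sub_eq_self]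

theorem log_inv_le_add_rpow_neg (d : ℝ≥0∞) {R a : ℝ} (hR : 0 < R) (ha : 0 < a) :
    ENNReal.log d⁻¹ ≤ (Real.log (1 / R) : EReal) +
      ((ENNReal.ofReal (R ^ a / a) * d ^ (-a) : ℝ≥0∞) : EReal) := by
  have hRa : 0 < R ^ a / a := by positivity
  induction d with
  | top => simp
  | coe d =>
  rw [← ENNReal.ofReal_coe_nnreal]
  rcases d.coe_nonneg.eq_or_lt' with hd | hd
  · simp [hd, ENNReal.zero_rpow_of_neg (neg_lt_zero.mpr ha), ENNReal.mul_top, hRa]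
  have hlog := Real.log_le_rpow_div (div_pos hR hd).le ha
  rw [Real.log_div hR.ne' hd.ne', Real.div_rpow hR.le hd.le] at hlog
  rw [← ENNReal.ofReal_inv_of_pos hd, ENNReal.log_ofReal_of_pos (by positivity), Real.log_inv,
    ENNReal.ofReal_rpow_of_pos hd, ← ENNReal.ofReal_mul hRa.le, EReal.coe_ennreal_ofReal,
    max_eq_left (by positivity), ← EReal.coe_add, EReal.coe_le_coe_iff, one_div, Real.log_inv,
    Real.rpow_neg hd.le, ← div_eq_mul_inv, div_right_comm]
  linarith

theorem sigma_ne_top (A : Set (Cn n)) : sigma n A ≠ ∞ :=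
  ((sigma_le_one A).trans_lt ENNReal.one_lt_top).ne

theorem PowerIntegralBound.logIntegralBound (h : PowerIntegralBound E) : LogIntegralBound E := by
  obtain ⟨a, C, ha, hC, h⟩ := h
  refine ⟨C / a, by positivity, fun x hx R hR => ?_⟩
  have hmeas : Measurable fun z => ndSet z E ^ (-a) := (measurable_ndSet E).pow_const _
  refine eintegral_le (sigma_ne_top _) (hmeas.const_mul _) (by positivity) ?_
    fun z => log_inv_le_add_rpow_neg _ hR ha
  rw [lintegral_const_mul _ hmeas]
  refine (mul_le_mul_right (h x hx R hR) _).trans_eq ?_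
  rw [← ENNReal.ofReal_mul (by positivity), Real.rpow_sub hR, Real.rpow_natCast]
  congr 1
  field_simp

theorem LogIntegralBound.uhc (h : LogIntegralBound E) : UHC E := by
  obtain ⟨C, hC, h⟩ := h
  obtain ⟨c, hc, hlow⟩ := (regular_sigma n).exists_le_measure_nball
  refine ⟨Real.exp (-(C / c) - 1), Real.exp_pos _, ?_, fun x hx r hr hr2 => ?_⟩
  · rw [Real.exp_lt_one_iff]
    linarith [div_pos hC hc]
  by_contra! hlt
  set A := nball (S n) x r
  have hlog : ∀ z ∈ A, ((Real.log (1 / r) + (C / c + 1) : ℝ) : EReal) ≤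
      ENNReal.log (ndSet z E)⁻¹ := by
    intro z hz
    have hd : ndSet z E ≤ ENNReal.ofReal (Real.exp (-(C / c) - 1) * r) :=
      (le_iSup₂ (f := fun y (_ : y ∈ A) => ndSet y E) z hz).trans hlt.le
    refine le_of_eq_of_le ?_ (ENNReal.log_monotone (ENNReal.inv_le_inv.mpr hd))
    rw [← ENNReal.ofReal_inv_of_pos (by positivity), ENNReal.log_ofReal_of_pos (by positivity),
      Real.log_inv, Real.log_mul (Real.exp_pos _).ne' hr.ne', Real.log_exp, one_div, Real.log_inv]
    congr 1
    ring
  have hle := (mul_measureReal_le_eintegral (sigma_ne_top A)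
    (measurableSet_nball measurableSet_S x r) hlog).trans (h x hx r hr)
  have hM : c * r ^ n ≤ (sigma n).real A := by
    rw [← ENNReal.ofReal_le_ofReal_iff measureReal_nonneg, ofReal_measureReal (sigma_ne_top A),
      ← Real.rpow_natCast]
    exact hlow x hx r hr hr2
  have hCM : C * r ^ n ≤ C / c * (sigma n).real A :=
    calc C * r ^ n = C / c * (c * r ^ n) := by field_simp
      _ ≤ C / c * (sigma n).real A := by gcongr
  rw [EReal.coe_le_coe_iff] at hle
  linarith [(show 0 < c * r ^ n by positivity).trans_le hM]

end LogIntegral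

section HoleCondition

theorem Regular.exists_separatedCardLE {m : ℝ} (hμ : Regular X μ m) :
    ∃ C : ℝ, 0 < C ∧ ∀ x ∈ S n, ∀ δ R : ℝ, 0 < δ → δ ≤ 1 → δ ≤ R →
      SeparatedCardLE (nball (S n) x R) δ (C * (R / δ) ^ m) := by
  obtain ⟨c, hc, hlow⟩ := hμ.exists_le_measure_nball
  obtain ⟨D, hD, hup⟩ := hμ.exists_measure_nball_le
  refine ⟨D * 24 ^ m / c, by positivity, fun x hx δ R hδ hδ1 hR t ht hs => ?_⟩
  have hR0 : 0 < R := hδ.trans_le hR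
  have hball : ∀ y ∈ t, nball X y (δ / 6) ⊆ nball X x (4 * R) := fun y hy =>
    (nball_subset_nball hμ.subset_clB (S_subset_clB hx) (S_subset_clB (ht hy).1) _).trans
      (nball_mono subset_rfl x (by linarith [(ht hy).2]))
  have hmeas := (hs.card_mul_le_measure hμ.subset_clB (fun y hy => (ht hy).1)
    (fun y => measurableSet_nball hμ.measurableSet y _) (fun y _ => subset_rfl) hball
    fun y hy => hlow y (ht hy).1 (δ / 6) (by positivity) (by linarith)).trans
    (hup x hx (4 * R) (by positivity))
  rw [← ENNReal.ofReal_natCast, ← ENNReal.ofReal_mul (by positivity),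
    ENNReal.ofReal_le_ofReal_iff (by positivity)] at hmeas
  calc (t.card : ℝ) = t.card * (c * (δ / 6) ^ m) / (c * (δ / 6) ^ m) := by field_simp
    _ ≤ D * (4 * R) ^ m / (c * (δ / 6) ^ m) := by gcongr
    _ = D / c * (4 * R / (δ / 6)) ^ m := by
        rw [mul_div_mul_comm, ← Real.div_rpow (by positivity) (by positivity)]
    _ = D / c * (24 * (R / δ)) ^ m := by ring_nf
    _ = D * 24 ^ m / c * (R / δ) ^ m := by
        rw [Real.mul_rpow (by norm_num) (by positivity)]
        ring

/-- The part of the sphere whose distance to `E` is comparable to `r`. The hole condition puts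
much of the measure near `E` into this set, and these sets are disjoint for the scales
`r = R * (c / 6) ^ j`. -/
def shell (E : Set (Cn n)) (c r : ℝ) : Set (Cn n) :=
  {z ∈ S n | ENNReal.ofReal (c * r) ≤ ndSet z E ∧ ndSet z E < ENNReal.ofReal (6 * r)}

theorem measurableSet_shell (E : Set (Cn n)) (c r : ℝ) : MeasurableSet (shell E c r) :=
  measurableSet_S.inter ((measurable_ndSet E measurableSet_Ici).inter
    (measurable_ndSet E measurableSet_Iio))

theorem disjoint_shell (E : Set (Cn n)) {c r r' : ℝ} (h : 6 * r' ≤ c * r) :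
    Disjoint (shell E c r) (shell E c r') :=
  Set.disjoint_left.mpr fun _ hz hz' =>
    (hz.2.1.trans_lt hz'.2.2).not_ge (ENNReal.ofReal_le_ofReal h)

theorem pairwise_disjoint_shell (E : Set (Cn n)) {c R : ℝ} (hc : 0 < c) (hc6 : c ≤ 6)
    (hR : 0 ≤ R) : Pairwise fun i j : ℕ =>
      Disjoint (shell E c (R / (6 / c) ^ i)) (shell E c (R / (6 / c) ^ j)) := by
  refine (pairwise_disjoint_on _).mpr fun i j hij => disjoint_shell E ?_
  have hL : 1 ≤ 6 / c := (one_le_div hc).mpr hc6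
  calc 6 * (R / (6 / c) ^ j) ≤ 6 * (R / (6 / c) ^ (i + 1)) := by gcongr; exact hij
    _ = c * (R / (6 / c) ^ i) := by
      rw [pow_succ]
      field_simp

theorem UHC.exists_hole (hES : E ⊆ S n) (h : UHC E) :
    ∃ c : ℝ, 0 < c ∧ c < 1 ∧ ∀ w ∈ E, ∀ r : ℝ, 0 < r → r ≤ 2 →
      ∃ y ∈ S n, nball (S n) y (c * r) ⊆ shell E c r ∩ nball (S n) w (6 * r) := by
  obtain ⟨C, hC, hC1, h⟩ := h
  refine ⟨C / 12, by positivity, by linarith, fun w hw r hr hr2 => ?_⟩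
  have hCr : 0 < C * r := by positivity
  have hlt : ENNReal.ofReal (C * r / 2) < ⨆ y ∈ nball (S n) w r, ndSet y E :=
    ((ENNReal.ofReal_lt_ofReal_iff hCr).mpr (half_lt_self hCr)).trans_le (h w (hES hw) r hr hr2)
  obtain ⟨y, hlt⟩ := lt_iSup_iff.mp hlt
  obtain ⟨hyw, hy⟩ := lt_iSup_iff.mp hlt
  refine ⟨y, hyw.1, fun z hz => ?_⟩
  have hzw : nd z w < 6 * r := by
    have := nd_triangle (S_subset_clB hz.1) (S_subset_clB hyw.1) (S_subset_clB (hES hw))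
    nlinarith [hz.2, hyw.2]
  refine ⟨⟨hz.1, ofReal_le_ndSet_iff.mpr fun e he => ?_, ndSet_lt_ofReal_iff.mpr ⟨w, hw, hzw⟩⟩,
    hz.1, hzw⟩
  have htri := nd_triangle (S_subset_clB hyw.1) (S_subset_clB hz.1) (S_subset_clB (hES he))
  rw [nd_comm y z] at htri
  linarith [ofReal_le_ndSet_iff.mp hy.le e he, hz.2]

theorem UHC.exists_separatedCardLE_shell (hES : E ⊆ S n) (h : UHC E) :
    ∃ c B : ℝ, 0 < c ∧ c < 1 ∧ 0 < B ∧ ∀ x ∈ E, ∀ δ r R : ℝ, 0 < δ → δ ≤ r → r ≤ R → R ≤ 1 →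
      SeparatedCardLE (nball E x R) δ
        (B * (sigma n).real (shell E c r ∩ nball (S n) x (21 * R)) / δ ^ n) := by
  obtain ⟨c, hc, hc1, hole⟩ := h.exists_hole hES
  obtain ⟨a, ha, hlow⟩ := (regular_sigma n).exists_le_measure_nball
  obtain ⟨C, hC, hpack⟩ := (regular_sigma n).exists_separatedCardLE
  refine ⟨c, C * 36 ^ n / (a * c ^ n), hc, hc1, by positivity,
    fun x hx δ r R hδ hδr hrR hR1 => ?_⟩
  have hr : 0 < r := hδ.trans_le hδr
  have hsub : nball E x R ⊆ S n := fun z hz => hES hz.1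
  obtain ⟨F, hFE, hFs, hcover⟩ := ((hpack x (hES hx) δ R hδ (by linarith) (by linarith)).mono
    (δ' := 36 * r) (nball_mono hES x le_rfl) (by linarith) le_rfl).exists_net hsub (by positivity)
  choose! y hyS hy using fun w (hw : w ∈ E) => hole w hw r hr (by linarith)
  have hmeas : F.card * ENNReal.ofReal (a * (c * r) ^ (n : ℝ)) ≤
      sigma n (shell E c r ∩ nball (S n) x (21 * R)) := by
    refine hFs.card_mul_le_measure S_subset_clB (hFE.trans hsub)
      (H := fun f => nball (S n) (y f) (c * r)) (fun f => measurableSet_nball measurableSet_S _ _)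
      (fun f hf => (hy f (hFE hf).1).trans (Set.inter_subset_right.trans ?_))
      (fun f hf => (hy f (hFE hf).1).trans (Set.inter_subset_inter_right _ ?_))
      fun f hf => hlow _ (hyS f (hFE hf).1) _ (by positivity) (by nlinarith)
    · exact nball_mono subset_rfl f (by linarith)
    · exact (nball_subset_nball S_subset_clB (S_subset_clB (hES hx)) (S_subset_clB (hsub (hFE hf)))
        _).trans (nball_mono subset_rfl x (by linarith [(hFE hf).2]))
  have hreal : F.card * (a * (c * r) ^ n) ≤
      (sigma n).real (shell E c r ∩ nball (S n) x (21 * R)) := by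
    rwa [← ENNReal.ofReal_le_ofReal_iff measureReal_nonneg, ofReal_measureReal (sigma_ne_top _),
      ENNReal.ofReal_mul (Nat.cast_nonneg _), ENNReal.ofReal_natCast, ← Real.rpow_natCast]
  refine (separatedCardLE_of_cover hcover fun f hf =>
    (hpack f (hsub (hFE hf)) δ (36 * r) hδ (by linarith) (by linarith)).mono
      (nball_mono hsub f le_rfl) le_rfl le_rfl).mono subset_rfl le_rfl ?_
  rw [Real.rpow_natCast]
  calc F.card * (C * (36 * r / δ) ^ n)
      = C * 36 ^ n / (a * c ^ n) * (F.card * (a * (c * r) ^ n)) / δ ^ n := by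
        rw [div_pow, mul_pow, mul_pow]
        field_simp
    _ ≤ _ := by gcongr

theorem UHC.exists_separatedCardLE (hES : E ⊆ S n) (h : UHC E) :
    ∃ L B : ℝ, 2 ≤ L ∧ 0 < B ∧ ∀ J : ℕ, 0 < J → ∀ x ∈ E, ∀ R : ℝ, 0 < R → R ≤ 1 →
      SeparatedCardLE (nball E x R) (R / L ^ J) (B / J * (L ^ J) ^ n) := by
  obtain ⟨c, B, hc, hc1, hB, hshell⟩ := h.exists_separatedCardLE_shell hES
  obtain ⟨D, hD, hup⟩ := (regular_sigma n).exists_measure_nball_le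
  have hL : 2 ≤ 6 / c := (le_div_iff₀ hc).mpr (by linarith)
  refine ⟨6 / c, B * (D * 21 ^ n), hL, by positivity, fun J hJ x hx R hR hR1 t ht hs => ?_⟩
  set L := 6 / c
  set Q : ℕ → Set (Cn n) := fun j => shell E c (R / L ^ j) ∩ nball (S n) x (21 * R)
  have hL0 : 0 < L := by linarith
  have hball : MeasurableSet (nball (S n) x (21 * R)) := measurableSet_nball measurableSet_S _ _
  have hvol : ∑ j ∈ Finset.range J, (sigma n).real (Q j) ≤ D * (21 * R) ^ n := by
    rw [← measureReal_biUnion_finset (fun i _ j _ hij => (pairwise_disjoint_shell E hc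
        (by linarith) hR.le hij).mono Set.inter_subset_left Set.inter_subset_left)
      (fun j _ => (measurableSet_shell _ _ _).inter hball) fun j _ => sigma_ne_top _]
    refine (measureReal_mono (Set.iUnion₂_subset fun j _ => Set.inter_subset_right)
      (sigma_ne_top _)).trans (ENNReal.toReal_le_of_le_ofReal (by positivity) ?_)
    rw [← Real.rpow_natCast]
    exact hup x (hES hx) _ (by positivity)
  have hcard : ∀ j ∈ Finset.range J,
      (t.card : ℝ) ≤ B * (sigma n).real (Q j) / (R / L ^ J) ^ n := fun j hj =>
    hshell x hx _ _ R (by positivity)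
      (by gcongr; exacts [by linarith, (Finset.mem_range.mp hj).le])
      (div_le_self hR.le (one_le_pow₀ (by linarith))) hR1 t ht hs
  have hsum := Finset.sum_le_sum hcard
  rw [Finset.sum_const, Finset.card_range, nsmul_eq_mul, ← Finset.sum_div, ← Finset.mul_sum]
    at hsum
  rw [div_mul_eq_mul_div, le_div_iff₀' (by positivity)]
  calc J * (t.card : ℝ) ≤ _ := hsum
    _ ≤ B * (D * (21 * R) ^ n) / (R / L ^ J) ^ n := by gcongr
    _ = B * (D * 21 ^ n) * (L ^ J) ^ n := by
      rw [mul_pow, div_pow]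
      field_simp

theorem separatedCardLE_div_pow (hES : E ⊆ S n) {k M : ℝ} (hk : 1 ≤ k)
    (h : ∀ x ∈ E, ∀ R : ℝ, 0 < R → R ≤ 1 → SeparatedCardLE (nball E x R) (R / k) M) (j : ℕ) :
    ∀ x ∈ E, ∀ R : ℝ, 0 < R → R ≤ 1 →
      SeparatedCardLE (nball E x R) (R / k ^ (j + 1)) (M ^ (j + 1)) := by
  induction j with
  | zero => simpa using h
  | succ j ih =>
    intro x hx R hR hR1
    have hRk : 0 < R / k := by positivity
    obtain ⟨F, hFE, hFs, hcover⟩ :=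
      (h x hx R hR hR1).exists_net (fun z hz => hES hz.1) hRk
    have hFM : (F.card : ℝ) ≤ M := h x hx R hR hR1 F hFE hFs
    have hM : 0 ≤ M := (Nat.cast_nonneg _).trans hFM
    refine (separatedCardLE_of_cover hcover fun f hf =>
      (ih f (hFE hf).1 (R / k) hRk ((div_le_self hR.le hk).trans hR1)).mono
        (nball_mono (fun z hz => hz.1) f le_rfl) le_rfl le_rfl).mono subset_rfl ?_ ?_
    · rw [div_div, ← pow_succ']
    · rw [pow_succ' M (j + 1)]
      gcongr

theorem inUpsilon_of_separatedCardLE_div (hES : E ⊆ S n) {k γ : ℝ} (hk : 1 < k) (hγ : 0 ≤ γ)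
    (h : ∀ x ∈ E, ∀ R : ℝ, 0 < R → R ≤ 1 → SeparatedCardLE (nball E x R) (R / k) (k ^ γ)) :
    InUpsilon E γ := by
  have hk0 : 0 < k := one_pos.trans hk
  refine inUpsilon_iff.mpr ⟨k ^ γ, by positivity, fun x hx δ R hδ hδR hR1 => ?_⟩
  have hR : 0 < R := hδ.trans_le hδR
  obtain ⟨i, hi, hi'⟩ := exists_nat_pow_near ((one_le_div hδ).mpr hδR) hk
  refine (separatedCardLE_div_pow hES hk.le h i x hx R hR hR1).mono subset_rfl ?_ ?_
  · exact (div_le_comm₀ hδ (by positivity)).mp hi'.le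
  · calc (k ^ γ) ^ (i + 1) = (k * k ^ i) ^ γ := by
          rw [← pow_succ', Real.rpow_pow_comm hk0.le]
      _ ≤ (k * (R / δ)) ^ γ := by gcongr
      _ = k ^ γ * (R / δ) ^ γ := Real.mul_rpow hk0.le (by positivity)

theorem UHC.exists_inUpsilon (hn : 1 ≤ n) (hES : E ⊆ S n) (h : UHC E) :
    ∃ γ : ℝ, γ < n ∧ InUpsilon E γ := by
  obtain ⟨L, B, hL, hB, hcard⟩ := h.exists_separatedCardLE hES
  obtain ⟨J, hJ⟩ := exists_nat_gt (2 * B)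
  have hJ0 : (0 : ℝ) < J := by linarith
  have hn' : (1 : ℝ) ≤ n := by exact_mod_cast hn
  have hk : 2 ≤ L ^ J := hL.trans (le_self_pow₀ (by linarith) (Nat.cast_pos.mp hJ0).ne')
  have hlog0 : 0 < Real.logb (L ^ J) 2 := Real.logb_pos (by linarith) one_lt_two
  have hlog1 : Real.logb (L ^ J) 2 ≤ 1 := by
    rwa [Real.logb_le_iff_le_rpow (by linarith) two_pos, Real.rpow_one]
  refine ⟨n - Real.logb (L ^ J) 2, by linarith, inUpsilon_of_separatedCardLE_div hES
    (k := L ^ J) (by linarith) (by linarith) fun x hx R hR hR1 =>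
    (hcard J (Nat.cast_pos.mp hJ0) x hx R hR hR1).mono subset_rfl le_rfl ?_⟩
  rw [Real.rpow_sub (by linarith), Real.rpow_logb (by linarith) (by linarith) two_pos,
    Real.rpow_natCast, div_eq_inv_mul _ (2 : ℝ)]
  gcongr
  rw [div_le_iff₀ hJ0]
  linarith

end HoleCondition

end NonIso

open NonIso in
theorem theorem2_general (n : ℕ) (hn : 1 ≤ n) (E : Set (Cn n)) (hES : E ⊆ S n) :
    List.TFAE [UHC E, ∃ s : ℝ, s < n ∧ SigmaCond E s, upperDim E < ((n : ℝ) : EReal),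
      PowerIntegralBound E, LogIntegralBound E, PackingIntegralBound E, VolumeBound E,
      VolumeIntegralBound E] := by
  have hub := exists_nonneg_inUpsilon_of_upperDim_lt (E := E) (Nat.cast_pos.mpr hn)
  tfae_have 1 → 3 := fun h => upperDim_lt_iff.mpr (h.exists_inUpsilon hn hES)
  tfae_have 3 → 2 := fun h =>
    have ⟨γ, hγ, hγn, hU⟩ := hub h
    ⟨γ, hγn, hU.exists_measure_nbhd_le hES (regular_sigma n) hγ⟩
  tfae_have 2 → 4 := fun ⟨s, hs, C, hC, h⟩ =>
    have ⟨a, ha, has⟩ := exists_between (sub_pos.mpr hs)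
    have ⟨C', h'⟩ := exists_lintegral_ndSet_rpow_neg_le (regular_sigma n) hC h ha.le has
    ⟨a, C', ha, h'⟩
  tfae_have 4 → 5 := PowerIntegralBound.logIntegralBound
  tfae_have 5 → 1 := LogIntegralBound.uhc
  tfae_have 3 → 6 := fun h =>
    have ⟨_, hγ, hγn, hU⟩ := hub h
    hU.packingIntegralBound hES hγ hγn
  tfae_have 6 → 3 := fun h => upperDim_lt_iff.mpr h.exists_inUpsilon
  tfae_have 3 → 8 := fun h =>
    have ⟨γ, hγ, hγn, hU⟩ := hub h
    have ⟨_, hC, h'⟩ := hU.exists_measure_nbhd_le hES (regular_V n) hγ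
    ⟨n + 1 - γ, by linarith, fun _ => exists_lintegral_ndSet_rpow_neg_le (regular_V n) hC h'⟩
  tfae_have 8 → 7 := VolumeIntegralBound.volumeBound hES
  tfae_have 7 → 3 := fun ⟨s, _, hs, hC, h⟩ =>
    upperDim_lt_iff.mpr ⟨s, hs, inUpsilon_of_measure_nbhd_le hES (regular_V n) hC h⟩
  tfae_finish

theorem theorem2 (n : ℕ) (hn : 1 ≤ n) (E : Set (NonIso.Cn n)) (hES : E ⊆ NonIso.S n)
    (hE : IsClosed E) :
    List.TFAE [
      NonIso.UHC E,
      ∃ s : ℝ, s < n ∧ NonIso.SigmaCond E s,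
      NonIso.upperDim E < ((n : ℝ) : EReal),
      NonIso.PowerIntegralBound E,
      NonIso.LogIntegralBound E,
      NonIso.PackingIntegralBound E,
      NonIso.VolumeBound E,
      NonIso.VolumeIntegralBound E] :=
  theorem2_general n hn E hES
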